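/- Let $\mathcal H$ and $\mathcal G$ be real Hilbert spaces. Write $A\preccurlyeq B$ if $B-A$ is a positive (self-adjoint) bounded operator, let $\mathscr S(\mathcal H)$ be the set of positive operators $A$ on $\mathcal H$ such that $\alpha\,\mathrm{Id}\preccurlyeq A$ for some $\alpha>0$, and equip it with the Thompson metric $$d_{\mathcal H}(A,B)=\ln\max\{g(A,B),g(B,A)\},\qquad g(A,B)=\inf\{\lambda>0 : A\preccurlyeq\lambda B\}$$ (with $d_{\mathcal H}=0$ if $\mathcal H=\{0\}$); likewise for $\mathcal G$. A bounded linear operator $L$ is *bounded below* if $\alpha\|x\|\le\|Lx\|$ for some $\alpha>0$ and all $x$. For a bounded linear $L:\mathcal H\to\mathcal G$, $\rho>0$ and a set-valued operator $C:\mathcal G\to2^{\mathcal G}$, let $$L\diamond_\rho C=\bigl(L^*\circ(C+\rho^{-1}\mathrm{Id}_{\mathcal G})^{-1}\circ L\bigr)^{-1}-\rho^{-1}\mathrm{Id}_{\mathcal H},\qquad L\blacktriangleright_\rho C=\bigl(L\diamond_{1/\rho}C^{-1}\bigr)^{-1},$$ where inverses, compositions, sums and differences are those of set-valued operators; $L\blacktriangleright_\rho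 C$ is the resolvent cocomposition of $C$ and $L$ with parameter $\rho$. Let $\gamma\in(0,+\infty)$, let $t\in(-1,1)$, and let $B$ be a bounded linear operator on $\mathcal G$ which is the norm limit of a sequence of invertible bounded linear operators on $\mathcal G$. (i) Let $L:\mathcal H\to\mathcal G$ be a bounded linear operator that is bounded below and satisfies $\|L\|\le1$. Then $X\mapsto L\blacktriangleright_\gamma(B^*\circ X^t\circ B)$ is a well-defined (single-valued) map $\varphi:\mathscr S(\mathcal G)\to\mathscr S(\mathcal H)$ if and only if $B\circ L$ is bounded below (in particular if $B$ is invertible). Whenever it is, $\varphi$ is $|t|$-Lipschitz: $$d_{\mathcal H}(\varphi(X),\varphi(Y))\le|t|\,d_{\mathcal G}(X,Y)\qquad\text{for all }X,Y\in\mathscr S(\mathcal G).$$ (ii) Suppose that $\mathcal H=\mathcal G$, that $L$ is a bounded linear operator on $\mathcal G$ that is bounded below with $\|L\|\le1$, and that $B\circ L$ is bounded below. Then there is exactly one $X\in\mathscr S(\mathcal G)$ such that $X=L\blacktriangleright_\gamma(B^*\circ X^t\circ B)$. -/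

import Mathlib

open scoped Pointwise Topology

noncomputable section

namespace ResolventComposition

variable {E F K : Type*}

/-! ### Set-valued operators -/

/-- The inverse of a set-valued operator: its graph is flipped. -/
def inverse (A : E → Set F) : F → Set E := fun y => {x | y ∈ A x}

/-- The composition `A ∘ B` of set-valued operators. -/
def compose (A : F → Set K) (B : E → Set F) : E → Set K :=
  fun x => {z | ∃ y ∈ B x, z ∈ A y}

/-- A single-valued operator, defined everywhere, seen as a set-valued operator. -/
def single (T : E → F) : E → Set F := fun x => {T x}

variable {H G : Type*}
  [NormedAddCommGroup H] [InnerProductSpace ℝ H] [CompleteSpace H]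
  [NormedAddCommGroup G] [InnerProductSpace ℝ G] [CompleteSpace G]

/-- The parallel composition `(L* ∘ B⁻¹ ∘ L)⁻¹` of `B` by `L*`. -/
def parallelComp (L : H →L[ℝ] G) (B : G → Set G) : H → Set H :=
  inverse (compose (single (ContinuousLinearMap.adjoint L))
    (compose (inverse B) (single L)))

/-- The resolvent composition: the parallel composition of `B + γ⁻¹ Id` by `L*`, minus `γ⁻¹ Id`.
Sums and differences of set-valued operators are pointwise Minkowski sums and differences. -/
def resolventComp (L : H →L[ℝ] G) (γ : ℝ) (B : G → Set G) : H → Set H :=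
  parallelComp L (B + single (fun y : G => γ⁻¹ • y)) - single (fun x : H => γ⁻¹ • x)

/-- The resolvent cocomposition of `B` and `L` with parameter `γ`: the inverse of the resolvent
composition of `B⁻¹` and `L` with parameter `1 / γ`. -/
def resolventCocomp (L : H →L[ℝ] G) (γ : ℝ) (B : G → Set G) : H → Set H :=
  inverse (resolventComp L (1 / γ) (inverse B))

/-! ### Strictly positive operators and the Thompson metric -/

/-- `L` is bounded below: `α ‖x‖ ≤ ‖L x‖` for some `α > 0` and all `x`. -/
def IsBoundedBelow (L : H →L[ℝ] G) : Prop :=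
  ∃ α : ℝ, 0 < α ∧ ∀ x : H, α * ‖x‖ ≤ ‖L x‖

/-- The set of strictly positive operators on `H`; `≤` is the Loewner order. -/
def strictlyPositive (H : Type*) [NormedAddCommGroup H] [InnerProductSpace ℝ H]
    [CompleteSpace H] : Set (H →L[ℝ] H) :=
  {A | A.IsPositive ∧ ∃ α : ℝ, 0 < α ∧ α • ContinuousLinearMap.id ℝ H ≤ A}

/-- `g(A, B) = inf {λ > 0 | A ≤ λ B}`. -/
def thompsonGauge (A B : H →L[ℝ] H) : ℝ :=
  sInf {l : ℝ | 0 < l ∧ A ≤ l • B}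

/-- The Thompson metric `ln (max {g(A, B), g(B, A)})`. -/
def thompsonDist (A B : H →L[ℝ] H) : ℝ :=
  Real.log (max (thompsonGauge A B) (thompsonGauge B A))

/-- The real power `X ^ t` of a strictly positive operator `X`. The spectrum of `X` lies in
`(0, ‖X‖]`, where `s ^ t` is the sum of its Taylor series around `‖X‖`, the binomial series
`‖X‖ ^ t * ∑ₖ (t choose k) (s / ‖X‖ - 1) ^ k`. For `X` strictly positive,
`‖X / ‖X‖ - Id‖ < 1`, so that the series of operators converges absolutely. -/
def operatorRpow (X : G →L[ℝ] G) (t : ℝ) : G →L[ℝ] G :=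
  (‖X‖ ^ t) • ∑' k : ℕ, Ring.choose t k • (‖X‖⁻¹ • X - 1) ^ k

/-- The operator `B* ∘ X ^ t ∘ B`. -/
def congrRpow (B X : G →L[ℝ] G) (t : ℝ) : G →L[ℝ] G :=
  ContinuousLinearMap.adjoint B ∘L operatorRpow X t ∘L B

end ResolventComposition

end

noncomputable section

namespace ResolventComposition

section

/-! ### Positive operators on a real Hilbert space -/

section Positive

variable {E : Type*} [NormedAddCommGroup E] [InnerProductSpace ℝ E]

/-! Let `M = Id - L L*`, which is positive because `‖L‖ ≤ 1`. For a positive operator `C`, unfolding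
the inverses shows that the cocomposition sends `x` to `L* u`, where `u = C (L x - γ M u)`. As `Id +
γ C M` is invertible (`isUnit_one_add_mul`), `u` is unique and the cocomposition is a bounded
operator. Its form at `x` is the minimum over `z` of `⟨C (L x - γ M z), L x - γ M z⟩ + γ ⟨M z, z⟩`.
Hence `C ≤ c D` with `c ≥ 1` passes to the cocompositions with the same `c`
(`cocompOperator_le_smul`). With `C = B* X^t B`, the choice `z = 0` shows that strict positivity
forces `B L` to be bounded below; the equation for `u` gives the converse.

The factor `|t|` comes from the Löwner-Heinz inequality: `X ≤ c Y` and `Y ≤ c X` give `X^t ≤ c^|t|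
Y^t` (`operatorRpow_le_smul`). For `0 < τ < 1`, `X^(-τ)` is a positive multiple of `∫ s^(-τ) (s +
X)⁻¹ ds`, which is antitone in `X` because inversion is; inverting once more makes `X^τ` monotone.
The integral agrees with the binomial series because its moments obey the recursion of the binomial
coefficients.

A Thompson distance at most `r` means `X ≤ e^r Y` and `Y ≤ e^r X`, so these order estimates are the
Lipschitz bound. The Thompson metric is complete, and Banach's fixed point theorem yields (ii). -/

theorem le_iff_forall_inner {A B : E →L[ℝ] E} (hA : A.IsSymmetric) (hB : B.IsSymmetric) :
    A ≤ B ↔ ∀ x, inner ℝ (A x) x ≤ inner ℝ (B x) x := by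
  rw [ContinuousLinearMap.le_def, ContinuousLinearMap.isPositive_iff]
  have h : (B - A).IsSymmetric := fun x y => by
    have h1 := hA x y
    have h2 := hB x y
    simp only [ContinuousLinearMap.coe_coe] at h1 h2
    simp [inner_sub_left, inner_sub_right, h1, h2]
  rw [and_iff_right h]
  simp [inner_sub_left]

theorem inner_le_of_le {A B : E →L[ℝ] E} (h : A ≤ B) (x : E) :
    inner ℝ (A x) x ≤ inner ℝ (B x) x := by
  have := ContinuousLinearMap.IsPositive.inner_nonneg_left h x
  simpa [inner_sub_left] using this

theorem isSymmetric_smul_one (c : ℝ) : (c • (1 : E →L[ℝ] E)).IsSymmetric := fun x y => by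
  simp [inner_smul_left, inner_smul_right]

theorem isSymmetric_smul {A : E →L[ℝ] E} (hA : A.IsSymmetric) (c : ℝ) :
    (c • A).IsSymmetric := fun x y => by
  have := hA x y
  simp only [ContinuousLinearMap.coe_coe] at this
  simp [inner_smul_left, inner_smul_right, this]

theorem inner_map_self_le_norm (A : E →L[ℝ] E) (x : E) :
    inner ℝ (A x) x ≤ ‖A‖ * ‖x‖ ^ 2 := by
  calc inner ℝ (A x) x ≤ ‖A x‖ * ‖x‖ := real_inner_le_norm _ _
    _ ≤ ‖A‖ * ‖x‖ * ‖x‖ := by gcongr; exact A.le_opNorm x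
    _ = _ := by ring

/-- The Cauchy-Schwarz inequality for the form of a positive operator. -/
theorem inner_map_sq_le {T : E →L[ℝ] E} (hT : T.IsPositive) (x y : E) :
    inner ℝ (T x) y ^ 2 ≤ inner ℝ (T x) x * inner ℝ (T y) y := by
  have h := discrim_le_zero (a := inner ℝ (T y) y) (b := 2 * inner ℝ (T x) y)
    (c := inner ℝ (T x) x) fun s => by
      have h := hT.inner_nonneg_left (x + s • y)
      have h' : inner ℝ (T y) x = inner ℝ (T x) y := by
        rw [hT.inner_left_eq_inner_right, real_inner_comm]
      simp only [map_add, map_smul, inner_add_left, inner_add_right, inner_smul_left,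
        inner_smul_right, conj_trivial, h'] at h
      linarith
  rw [discrim] at h
  linarith

/-- Cauchy-Schwarz for the form, taken at `x` and `T x`, gives `‖T x‖⁴ ≤ ⟨T x, x⟩ c ‖T x‖²`. -/
theorem norm_map_sq_le {T : E →L[ℝ] E} (hT : T.IsPositive) {c : ℝ}
    (hc : ∀ x, inner ℝ (T x) x ≤ c * ‖x‖ ^ 2) (x : E) :
    ‖T x‖ ^ 2 ≤ c * inner ℝ (T x) x := by
  have h := inner_map_sq_le hT x (T x)
  rw [real_inner_self_eq_norm_sq] at h
  have h0 := hT.inner_nonneg_left x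
  rcases eq_or_ne (T x) 0 with h1 | h1
  · simp [h1]
  · have h2 : 0 < ‖T x‖ ^ 2 := by positivity
    have h3 := mul_le_mul_of_nonneg_left (hc (T x)) h0
    nlinarith

theorem norm_le_of_forall_inner_le {T : E →L[ℝ] E} (hT : T.IsPositive) {c : ℝ} (h0 : 0 ≤ c)
    (hc : ∀ x, inner ℝ (T x) x ≤ c * ‖x‖ ^ 2) : ‖T‖ ≤ c := by
  refine T.opNorm_le_bound h0 fun x => ?_
  have h1 := norm_map_sq_le hT hc x
  have h2 := mul_le_mul_of_nonneg_left (hc x) h0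
  exact abs_le_of_sq_le_sq' (by nlinarith) (by positivity) |>.2

theorem isUnit_of_coercive [CompleteSpace E] {A : E →L[ℝ] E} {α : ℝ} (hα : 0 < α)
    (h : ∀ x, α * ‖x‖ ^ 2 ≤ inner ℝ (A x) x) : IsUnit A :=
  ContinuousLinearMap.isUnit_of_forall_le_norm_inner_map A (c := ⟨α, hα.le⟩) hα fun x => by
    have := h x
    rw [Real.norm_eq_abs]
    refine le_trans ?_ (le_abs_self _)
    rw [mul_comm]
    exact this

theorem inverse_apply_apply {A : E →L[ℝ] E} (hA : IsUnit A) (x : E) : Ring.inverse A (A x) = x :=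
  DFunLike.congr_fun (Ring.inverse_mul_cancel A hA) x

theorem apply_inverse_apply {A : E →L[ℝ] E} (hA : IsUnit A) (x : E) : A (Ring.inverse A x) = x :=
  DFunLike.congr_fun (Ring.mul_inverse_cancel A hA) x

/-- Inversion is antitone: the form of the inverse decreases as the operator increases. -/
theorem inner_le_of_map_eq {A B : E →L[ℝ] E} (hA : A.IsPositive) (hAB : A ≤ B) {u v x : E}
    (hu : A u = x) (hv : B v = x) : inner ℝ v x ≤ inner ℝ u x := by
  -- Expanding gives `0 ≤ ⟨x, u⟩ - 2 ⟨x, v⟩ + ⟨A v, v⟩`, and `⟨A v, v⟩ ≤ ⟨B v, v⟩ = ⟨x, v⟩`.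
  have h1 := hA.inner_nonneg_left (u - v)
  have h2 := inner_le_of_le hAB v
  have h3 : inner ℝ (A v) u = inner ℝ x v := by
    rw [hA.inner_left_eq_inner_right, hu, real_inner_comm]
  simp only [map_sub, inner_sub_left, inner_sub_right, hu, h3] at h1
  rw [hv] at h2
  rw [real_inner_comm x v, real_inner_comm x u]
  linarith

theorem smul_le_smul_of_le {A B : E →L[ℝ] E} (h : A ≤ B) {c : ℝ} (hc : 0 ≤ c) :
    c • A ≤ c • B := by
  rw [ContinuousLinearMap.le_def, ← smul_sub]
  exact ContinuousLinearMap.IsPositive.smul_of_nonneg h hc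

theorem smul_le_smul_of_coeff_le {A : E →L[ℝ] E} (hA : A.IsPositive) {c d : ℝ} (h : c ≤ d) :
    c • A ≤ d • A := by
  rw [ContinuousLinearMap.le_def, ← sub_smul]
  exact hA.smul_of_nonneg (sub_nonneg.2 h)

theorem le_norm_smul_one {A : E →L[ℝ] E} (hA : A.IsPositive) : A ≤ ‖A‖ • (1 : E →L[ℝ] E) := by
  rw [le_iff_forall_inner hA.isSymmetric (isSymmetric_smul_one _)]
  intro x
  simpa [inner_smul_left] using inner_map_self_le_norm A x

variable [CompleteSpace E]

theorem mem_strictlyPositive_iff {A : E →L[ℝ] E} :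
    A ∈ strictlyPositive E ↔
      A.IsPositive ∧ ∃ α : ℝ, 0 < α ∧ ∀ x, α * ‖x‖ ^ 2 ≤ inner ℝ (A x) x := by
  refine and_congr_right fun hA => exists_congr fun α => and_congr_right fun _ => ?_
  rw [show ContinuousLinearMap.id ℝ E = 1 from rfl,
    le_iff_forall_inner (isSymmetric_smul_one α) hA.isSymmetric]
  simp [inner_smul_left]

theorem mem_strictlyPositive_of_inner {A : E →L[ℝ] E} (hA : A.IsSymmetric) {α : ℝ} (hα : 0 < α)
    (h : ∀ x, α * ‖x‖ ^ 2 ≤ inner ℝ (A x) x) : A ∈ strictlyPositive E :=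
  mem_strictlyPositive_iff.2 ⟨(ContinuousLinearMap.isPositive_iff A).2
    ⟨hA, fun x => le_trans (by positivity) (h x)⟩, α, hα, h⟩

theorem smul_one_mem_strictlyPositive {c : ℝ} (hc : 0 < c) :
    c • (1 : E →L[ℝ] E) ∈ strictlyPositive E :=
  mem_strictlyPositive_of_inner (isSymmetric_smul_one c) hc fun x => by simp [inner_smul_left]

theorem smul_mem_strictlyPositive {c : ℝ} (hc : 0 < c) {A : E →L[ℝ] E}
    (hA : A ∈ strictlyPositive E) : c • A ∈ strictlyPositive E := by
  obtain ⟨hp, α, hα, h⟩ := mem_strictlyPositive_iff.1 hA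
  refine mem_strictlyPositive_of_inner (isSymmetric_smul hp.isSymmetric c) (mul_pos hc hα)
    fun x => ?_
  have := mul_le_mul_of_nonneg_left (h x) hc.le
  simpa [inner_smul_left, mul_assoc] using this

theorem norm_pos_of_mem_strictlyPositive [Nontrivial E] {A : E →L[ℝ] E}
    (hA : A ∈ strictlyPositive E) : 0 < ‖A‖ := by
  obtain ⟨-, α, hα, h⟩ := mem_strictlyPositive_iff.1 hA
  obtain ⟨x, hx⟩ := exists_ne (0 : E)
  rw [norm_pos_iff]
  rintro rfl
  have := h x
  have h2 : 0 < α * ‖x‖ ^ 2 := by positivity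
  simp at this
  linarith

/-- `α ≤ A ≤ ‖A‖` places `1 - A / ‖A‖` between `0` and `1 - α / ‖A‖`, inside the disc of convergence
of the binomial series. -/
theorem norm_normalized_sub_one_lt [Nontrivial E] {A : E →L[ℝ] E}
    (hA : A ∈ strictlyPositive E) : ‖‖A‖⁻¹ • A - 1‖ < 1 := by
  have hn := norm_pos_of_mem_strictlyPositive hA
  obtain ⟨hp, α, hα, h⟩ := mem_strictlyPositive_iff.1 hA
  have hle : ∀ x, inner ℝ ((1 - ‖A‖⁻¹ • A) x) x = ‖x‖ ^ 2 - ‖A‖⁻¹ * inner ℝ (A x) x := fun x => by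
    simp [inner_sub_left, inner_smul_left]
  have hpos : (1 - ‖A‖⁻¹ • A).IsPositive := by
    have := smul_le_smul_of_le (le_norm_smul_one hp) (inv_nonneg.2 hn.le)
    rwa [smul_smul, inv_mul_cancel₀ hn.ne', one_smul] at this
  obtain ⟨x, hx⟩ := exists_ne (0 : E)
  have hαA : α ≤ ‖A‖ := by
    have h1 := (h x).trans (inner_map_self_le_norm A x)
    exact le_of_mul_le_mul_right h1 (by positivity)
  rw [← norm_neg, neg_sub]
  refine (norm_le_of_forall_inner_le hpos (c := 1 - ‖A‖⁻¹ * α) ?_ fun x => ?_).trans_lt ?_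
  · rw [sub_nonneg, inv_mul_le_iff₀ hn]
    simpa using hαA
  · rw [hle]
    have := mul_le_mul_of_nonneg_left (h x) (inv_nonneg.2 hn.le)
    linarith
  · have : 0 < ‖A‖⁻¹ * α := by positivity
    linarith

end Positive

end

section

/-! ### The binomial series of operators -/

theorem choose_succ_mul (t : ℝ) (k : ℕ) :
    Ring.choose t (k + 1) * (k + 1) = Ring.choose t k * (t - k) := by
  have := Ring.choose_smul_choose t (Nat.le_succ k)
  simp only [Nat.succ_eq_add_one, Nat.choose_succ_self_right, Nat.add_sub_cancel_left,
    Ring.choose_one_right, nsmul_eq_mul, Nat.cast_add, Nat.cast_one] at this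
  linarith

/-- By the recursion and `|t - k| ≤ k + 1`. The binomial series is thus dominated by a geometric
one. -/
theorem abs_choose_le_one {t : ℝ} (ht : |t| ≤ 1) (k : ℕ) : |Ring.choose t k| ≤ 1 := by
  induction k with
  | zero => simp
  | succ k ih =>
    have h := congrArg abs (choose_succ_mul t k)
    have hk : (0 : ℝ) < k + 1 := by positivity
    rw [abs_mul, abs_mul, abs_of_pos hk] at h
    have h1 : |t - k| ≤ k + 1 := by
      refine (abs_sub _ _).trans ?_
      rw [Nat.abs_cast]
      linarith
    have h2 : |Ring.choose t k| * |t - k| ≤ 1 * (k + 1) :=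
      mul_le_mul ih h1 (abs_nonneg _) zero_le_one
    rw [← h] at h2
    exact le_of_mul_le_mul_right h2 hk

variable {E : Type*} [NormedAddCommGroup E] [InnerProductSpace ℝ E]

/-- The binomial series `∑ₖ (t choose k) Wᵏ` of a contraction `W`. -/
def binomialSum (t : ℝ) (W : E →L[ℝ] E) : E →L[ℝ] E := ∑' k : ℕ, Ring.choose t k • W ^ k

theorem norm_pow_le_pow (W : E →L[ℝ] E) (k : ℕ) : ‖W ^ k‖ ≤ ‖W‖ ^ k := by
  induction k with
  | zero => exact ContinuousLinearMap.norm_id_le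
  | succ k ih =>
    rw [pow_succ, pow_succ]
    exact (norm_mul_le _ _).trans (by gcongr)

theorem summable_norm_binomial {t : ℝ} (ht : |t| ≤ 1) {W : E →L[ℝ] E} (hW : ‖W‖ < 1) :
    Summable fun k : ℕ => ‖Ring.choose t k • W ^ k‖ := by
  refine (summable_geometric_of_lt_one (norm_nonneg W) hW).of_nonneg_of_le
    (fun _ => norm_nonneg _) fun k => ?_
  rw [norm_smul]
  calc _ ≤ 1 * ‖W‖ ^ k := mul_le_mul (abs_choose_le_one ht k) (norm_pow_le_pow W k)
        (norm_nonneg _) zero_le_one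
    _ = _ := one_mul _

theorem binomialSum_zero (W : E →L[ℝ] E) : binomialSum 0 W = 1 := by
  rw [binomialSum, tsum_eq_single 0]
  · simp
  · intro k hk
    rw [Ring.choose_zero_pos ℝ (Nat.pos_of_ne_zero hk), zero_smul]

theorem binomialSum_apply_zero (t : ℝ) : binomialSum t (0 : E →L[ℝ] E) = 1 := by
  rw [binomialSum, tsum_eq_single 0]
  · simp
  · intro k hk
    simp [hk]

theorem isSymmetric_pow {W : E →L[ℝ] E} (h : W.IsSymmetric) (k : ℕ) (x y : E) :
    inner ℝ ((W ^ k) x) y = inner ℝ x ((W ^ k) y) := by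
  induction k generalizing x y with
  | zero => simp
  | succ k ih =>
    have := h x ((W ^ k) y)
    simp only [ContinuousLinearMap.coe_coe] at this
    conv_lhs => rw [pow_succ]
    conv_rhs => rw [pow_succ']
    change inner ℝ ((W ^ k) (W x)) y = inner ℝ x (W ((W ^ k) y))
    rw [ih, this]

variable [CompleteSpace E]

theorem hasSum_binomialSum {t : ℝ} (ht : |t| ≤ 1) {W : E →L[ℝ] E} (hW : ‖W‖ < 1) :
    HasSum (fun k : ℕ => Ring.choose t k • W ^ k) (binomialSum t W) :=
  (summable_norm_binomial ht hW).of_norm.hasSum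

/-- The Cauchy product of the two series has coefficients `Ring.choose (t + -t) k`, by the
Chu-Vandermonde identity. -/
theorem binomialSum_mul_binomialSum_neg {t : ℝ} (ht : |t| ≤ 1) {W : E →L[ℝ] E} (hW : ‖W‖ < 1) :
    binomialSum t W * binomialSum (-t) W = 1 := by
  rw [binomialSum, binomialSum, tsum_mul_tsum_eq_tsum_sum_antidiagonal_of_summable_norm
    (summable_norm_binomial ht hW) (summable_norm_binomial (by rwa [abs_neg]) hW),
    ← binomialSum_zero W, binomialSum]
  refine tsum_congr fun k => ?_
  rw [show (0 : ℝ) = t + -t by ring, Ring.add_choose_eq k (Commute.all t (-t)), Finset.sum_smul]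
  refine Finset.sum_congr rfl fun ij hij => ?_
  rw [smul_mul_smul_comm, ← pow_add, Finset.HasAntidiagonal.mem_antidiagonal.1 hij]

theorem hasSum_inner_binomialSum {t : ℝ} (ht : |t| ≤ 1) {W : E →L[ℝ] E} (hW : ‖W‖ < 1)
    (x y : E) :
    HasSum (fun k : ℕ => Ring.choose t k * inner ℝ ((W ^ k) x) y)
      (inner ℝ (binomialSum t W x) y) := by
  have h := ((innerSL ℝ y).comp (ContinuousLinearMap.apply ℝ E x)).hasSum
    (hasSum_binomialSum ht hW)
  simpa [Function.comp_def, real_inner_comm, inner_smul_left, inner_smul_right] using h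

theorem isSymmetric_binomialSum {t : ℝ} (ht : |t| ≤ 1) {W : E →L[ℝ] E} (hW : ‖W‖ < 1)
    (h : W.IsSymmetric) : (binomialSum t W).IsSymmetric := by
  intro x y
  have h1 := hasSum_inner_binomialSum ht hW x y
  have h2 := hasSum_inner_binomialSum ht hW y x
  have h3 : ∀ k, inner ℝ ((W ^ k) y) x = inner ℝ ((W ^ k) x) y := fun k => by
    rw [isSymmetric_pow h, real_inner_comm]
  simp only [h3] at h2
  exact (h1.unique h2).trans (real_inner_comm _ _)

end

section

/-! ### The moments of the Stieltjes kernel -/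

open MeasureTheory Set

/-- Near `0` the integrand is at most `s ^ (-τ)`, integrable as `τ < 1`; beyond `1` it is at most `s
^ (-τ - 1)`, integrable as `τ > 0`. -/
theorem integrableOn_rpow_neg_mul_inv {τ : ℝ} (h0 : 0 < τ) (h1 : τ < 1) :
    IntegrableOn (fun s : ℝ => s ^ (-τ) * (1 + s)⁻¹) (Ioi 0) := by
  have hm : ∀ S : Set ℝ, AEStronglyMeasurable (fun s : ℝ => s ^ (-τ) * (1 + s)⁻¹)
      (volume.restrict S) := fun S => by
    apply Measurable.aestronglyMeasurable
    fun_prop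
  rw [← Ioc_union_Ioi_eq_Ioi (zero_le_one' ℝ)]
  refine IntegrableOn.union ?_ ?_
  · have h : IntegrableOn (fun s : ℝ => s ^ (-τ)) (Ioc 0 1) :=
      (intervalIntegrable_iff_integrableOn_Ioc_of_le zero_le_one).1
        (intervalIntegral.intervalIntegrable_rpow' (by linarith))
    refine Integrable.mono' h (hm _) ((ae_restrict_iff' measurableSet_Ioc).2
      (Filter.Eventually.of_forall fun s hs => ?_))
    have hs0 : 0 < s := hs.1
    rw [Real.norm_of_nonneg (by positivity)]
    exact mul_le_of_le_one_right (by positivity) (inv_le_one_of_one_le₀ (by linarith))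
  · have h : IntegrableOn (fun s : ℝ => s ^ (-τ - 1)) (Ioi 1) :=
      integrableOn_Ioi_rpow_of_lt (by linarith) zero_lt_one
    refine Integrable.mono' h (hm _) ((ae_restrict_iff' measurableSet_Ioi).2
      (Filter.Eventually.of_forall fun s (hs : 1 < s) => ?_))
    have hs0 : 0 < s := by linarith
    rw [Real.norm_of_nonneg (by positivity), Real.rpow_sub_one hs0.ne', div_eq_mul_inv]
    gcongr
    linarith

theorem integrableOn_rpow_neg_mul {τ : ℝ} (h0 : 0 < τ) (h1 : τ < 1) {g : ℝ → ℝ} {K : ℝ}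
    (hg : ContinuousOn g (Ioi 0)) (hK : ∀ s, 0 < s → |g s| ≤ K * (1 + s)⁻¹) :
    IntegrableOn (fun s : ℝ => s ^ (-τ) * g s) (Ioi 0) := by
  refine Integrable.mono' ((integrableOn_rpow_neg_mul_inv h0 h1).const_mul K) ?_
    ((ae_restrict_iff' measurableSet_Ioi).2
      (Filter.Eventually.of_forall fun s (hs : 0 < s) => ?_))
  · refine ContinuousOn.aestronglyMeasurable (ContinuousOn.mul ?_ hg) measurableSet_Ioi
    exact ContinuousOn.rpow_const continuousOn_id fun s hs => Or.inl (ne_of_gt hs)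
  · rw [norm_mul, Real.norm_of_nonneg (by positivity), Real.norm_eq_abs]
    calc _ ≤ s ^ (-τ) * (K * (1 + s)⁻¹) := by gcongr; exact hK s hs
      _ = _ := by ring

/-- The moments `∫ s⁻ᵗ (1 + s)⁻⁽ᵏ⁺¹⁾ ds` over the positive half-line. -/
def stieltjesMoment (τ : ℝ) (k : ℕ) : ℝ := ∫ s in Ioi (0 : ℝ), s ^ (-τ) * ((1 + s) ^ (k + 1))⁻¹

theorem integrableOn_stieltjesMoment {τ : ℝ} (h0 : 0 < τ) (h1 : τ < 1) (k : ℕ) :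
    IntegrableOn (fun s : ℝ => s ^ (-τ) * ((1 + s) ^ (k + 1))⁻¹) (Ioi 0) := by
  refine integrableOn_rpow_neg_mul h0 h1 (K := 1) ?_ fun s hs => ?_
  · refine ContinuousOn.inv₀ (by fun_prop) fun s (hs : 0 < s) => by positivity
  · rw [abs_of_nonneg (by positivity), one_mul]
    refine inv_anti₀ (by positivity) ?_
    exact le_self_pow₀ (by linarith) (by omega)

theorem stieltjesMoment_zero_pos {τ : ℝ} (h0 : 0 < τ) (h1 : τ < 1) : 0 < stieltjesMoment τ 0 := by
  rw [stieltjesMoment, setIntegral_pos_iff_support_of_nonneg_ae]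
  · have : Function.support (fun s : ℝ => s ^ (-τ) * ((1 + s) ^ (0 + 1))⁻¹) ∩ Ioi 0 = Ioi 0 := by
      refine inter_eq_right.2 fun s (hs : 0 < s) => ?_
      have : 0 < s ^ (-τ) * ((1 + s) ^ (0 + 1))⁻¹ := by positivity
      exact this.ne'
    rw [this]
    simp
  · exact (ae_restrict_iff' measurableSet_Ioi).2
      (Filter.Eventually.of_forall fun s (hs : 0 < s) => by
        change (0 : ℝ) ≤ s ^ (-τ) * ((1 + s) ^ (0 + 1))⁻¹
        positivity)
  · exact integrableOn_stieltjesMoment h0 h1 0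

theorem stieltjesMoment_nonneg (τ : ℝ) (k : ℕ) : 0 ≤ stieltjesMoment τ k :=
  setIntegral_nonneg measurableSet_Ioi fun s (hs : 0 < s) => by positivity

theorem stieltjesMoment_le {τ : ℝ} (h0 : 0 < τ) (h1 : τ < 1) (k : ℕ) :
    stieltjesMoment τ k ≤ stieltjesMoment τ 0 := by
  refine setIntegral_mono_on (integrableOn_stieltjesMoment h0 h1 k)
    (integrableOn_stieltjesMoment h0 h1 0) measurableSet_Ioi fun s (hs : 0 < s) => ?_
  gcongr
  · linarith
  · omega

/-- The function `s ^ (1 - τ) / (1 + s) ^ (k + 1)` vanishes at `0` and at infinity, so its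
derivative has integral zero. Writing `s = (1 + s) - 1` expresses that derivative through the two
moment integrands. -/
theorem stieltjesMoment_succ {τ : ℝ} (h0 : 0 < τ) (h1 : τ < 1) (k : ℕ) :
    stieltjesMoment τ (k + 1) * (k + 1) = stieltjesMoment τ k * (k + τ) := by
  have hi := integrableOn_stieltjesMoment h0 h1 k
  have hi' := integrableOn_stieltjesMoment h0 h1 (k + 1)
  have hcont : ContinuousWithinAt (fun s : ℝ => s ^ (1 - τ) * ((1 + s) ^ (k + 1))⁻¹) (Ici 0) 0 := by
    refine ContinuousAt.continuousWithinAt (ContinuousAt.mul ?_ ?_)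
    · exact Real.continuousAt_rpow_const _ _ (Or.inr (by linarith))
    · exact ContinuousAt.inv₀ (by fun_prop) (by simp)
  have hderiv : ∀ s ∈ Ioi (0 : ℝ), HasDerivAt (fun s : ℝ => s ^ (1 - τ) * ((1 + s) ^ (k + 1))⁻¹)
      ((k + 1) * (s ^ (-τ) * ((1 + s) ^ (k + 1 + 1))⁻¹)
        - (k + τ) * (s ^ (-τ) * ((1 + s) ^ (k + 1))⁻¹)) s := by
    intro s (hs : 0 < s)
    have hne : (1 + s) ≠ 0 := by positivity
    have e1 : HasDerivAt (fun s : ℝ => s ^ (1 - τ)) ((1 - τ) * s ^ (1 - τ - 1)) s :=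
      Real.hasDerivAt_rpow_const (Or.inl hs.ne')
    have e2 : HasDerivAt (fun s : ℝ => (1 + s) ^ (k + 1)) (((k + 1 : ℕ) : ℝ) * (1 + s) ^ k * 1) s :=
      ((hasDerivAt_id' s).const_add 1).pow (k + 1)
    have e3 : HasDerivAt (fun s : ℝ => s ^ (1 - τ) * ((1 + s) ^ (k + 1))⁻¹)
        ((1 - τ) * s ^ (1 - τ - 1) * ((1 + s) ^ (k + 1))⁻¹ + s ^ (1 - τ) *
          (-(((k + 1 : ℕ) : ℝ) * (1 + s) ^ k * 1) / ((1 + s) ^ (k + 1)) ^ 2)) s :=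
      e1.mul (e2.inv (pow_ne_zero _ hne))
    refine e3.congr_deriv ?_
    have e4 : s ^ (1 - τ) = s ^ (-τ) * s := by
      rw [sub_eq_neg_add, Real.rpow_add_one hs.ne']
    rw [show 1 - τ - 1 = -τ by ring, e4]
    push_cast
    field_simp
    ring
  have hlim : Filter.Tendsto (fun s : ℝ => s ^ (1 - τ) * ((1 + s) ^ (k + 1))⁻¹) Filter.atTop
      (𝓝 0) := by
    refine tendsto_of_tendsto_of_tendsto_of_le_of_le' tendsto_const_nhds
      (tendsto_rpow_neg_atTop h0) ?_ ?_
    · filter_upwards [Filter.eventually_gt_atTop 0] with s hs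
      positivity
    · filter_upwards [Filter.eventually_gt_atTop 0] with s hs
      have e4 : s ^ (1 - τ) = s ^ (-τ) * s := by
        rw [sub_eq_neg_add, Real.rpow_add_one hs.ne']
      rw [e4, mul_assoc]
      refine mul_le_of_le_one_right (by positivity) ?_
      rw [← div_eq_mul_inv, div_le_one (by positivity)]
      exact le_trans (by linarith) (le_self_pow₀ (by linarith) (by omega) : 1 + s ≤ _)
  have h := integral_Ioi_of_hasDerivAt_of_tendsto hcont hderiv
    ((hi'.const_mul _).sub (hi.const_mul _)) hlim
  rw [integral_sub (hi'.const_mul _) (hi.const_mul _), integral_const_mul, integral_const_mul,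
    Real.zero_rpow (by linarith)] at h
  simp only [stieltjesMoment]
  linarith

theorem stieltjesMoment_eq {τ : ℝ} (h0 : 0 < τ) (h1 : τ < 1) (k : ℕ) :
    stieltjesMoment τ k = stieltjesMoment τ 0 * ((-1) ^ k * Ring.choose (-τ) k) := by
  induction k with
  | zero => simp
  | succ k ih =>
    have hk : (k + 1 : ℝ) ≠ 0 := by positivity
    have e1 := stieltjesMoment_succ h0 h1 k
    have e2 := choose_succ_mul (-τ) k
    refine mul_right_cancel₀ hk ?_
    rw [e1, ih, pow_succ]
    linear_combination (stieltjesMoment τ 0 * (-1) ^ k) * e2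

/-! ### The integral representation of negative powers -/

variable {E : Type*} [NormedAddCommGroup E] [InnerProductSpace ℝ E]

theorem shift_coercive {X : E →L[ℝ] E} {α : ℝ}
    (h : ∀ x, α * ‖x‖ ^ 2 ≤ inner ℝ (X x) x) (s : ℝ) (x : E) :
    (s + α) * ‖x‖ ^ 2 ≤ inner ℝ ((s • (1 : E →L[ℝ] E) + X) x) x := by
  have := h x
  simp only [add_apply, smul_apply, one_apply_eq_self,
     inner_add_left, inner_smul_left, real_inner_self_eq_norm_sq,
    conj_trivial]
  linarith

theorem inverse_smul {c : ℝ} (hc : c ≠ 0) {A : E →L[ℝ] E} (hA : IsUnit A) :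
    Ring.inverse (c • A) = c⁻¹ • Ring.inverse A := by
  have h1 : (c • A) * (c⁻¹ • Ring.inverse A) = 1 := by
    rw [smul_mul_smul_comm, mul_inv_cancel₀ hc, one_smul, Ring.mul_inverse_cancel A hA]
  have h2 : (c⁻¹ • Ring.inverse A) * (c • A) = 1 := by
    rw [smul_mul_smul_comm, inv_mul_cancel₀ hc, one_smul, Ring.inverse_mul_cancel A hA]
  exact Ring.inverse_unit (⟨c • A, c⁻¹ • Ring.inverse A, h1, h2⟩ : (E →L[ℝ] E)ˣ)

variable [CompleteSpace E]

/-- The quadratic form of the resolvent `(s + X)⁻¹`. -/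
def resolventForm (X : E →L[ℝ] E) (x : E) (s : ℝ) : ℝ :=
  inner ℝ (Ring.inverse (s • (1 : E →L[ℝ] E) + X) x) x

/-- The integral of `s⁻ᵗ ⟨(s + X)⁻¹ x, x⟩` over the positive half-line. -/
def stieltjesForm (τ : ℝ) (X : E →L[ℝ] E) (x : E) : ℝ :=
  ∫ s in Ioi (0 : ℝ), s ^ (-τ) * resolventForm X x s

theorem isUnit_shift {X : E →L[ℝ] E} (hX : X ∈ strictlyPositive E) {s : ℝ} (hs : 0 < s) :
    IsUnit (s • (1 : E →L[ℝ] E) + X) := by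
  obtain ⟨-, α, hα, h⟩ := mem_strictlyPositive_iff.1 hX
  exact isUnit_of_coercive (by positivity) (shift_coercive h s)

theorem isPositive_shift {X : E →L[ℝ] E} (hX : X ∈ strictlyPositive E) {s : ℝ} (hs : 0 < s) :
    (s • (1 : E →L[ℝ] E) + X).IsPositive :=
  (ContinuousLinearMap.isPositive_one.smul_of_nonneg hs.le).add hX.1

theorem integrableOn_stieltjesForm {τ : ℝ} (h0 : 0 < τ) (h1 : τ < 1) {X : E →L[ℝ] E}
    (hX : X ∈ strictlyPositive E) (x : E) :
    IntegrableOn (fun s : ℝ => s ^ (-τ) * resolventForm X x s) (Ioi 0) := by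
  obtain ⟨-, α, hα, h⟩ := mem_strictlyPositive_iff.1 hX
  -- Coercivity bounds the form by `‖x‖² / (s + α)`, and `s + α ≥ min α 1 * (1 + s)`.
  refine integrableOn_rpow_neg_mul h0 h1 (K := ‖x‖ ^ 2 * (min α 1)⁻¹) ?_ fun s hs => ?_
  · intro s hs
    obtain ⟨u, hu⟩ := isUnit_shift hX hs
    have hc : ContinuousAt (fun s : ℝ => s • (1 : E →L[ℝ] E) + X) s := by fun_prop
    have hi : ContinuousAt (fun s : ℝ => Ring.inverse (s • (1 : E →L[ℝ] E) + X)) s :=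
      ContinuousAt.comp (g := Ring.inverse)
        (by rw [← hu]; exact NormedRing.inverse_continuousAt u) hc
    exact ((hi.clm_apply continuousAt_const).inner continuousAt_const).continuousWithinAt
  · rw [resolventForm]
    set v := Ring.inverse (s • (1 : E →L[ℝ] E) + X) x with hv
    have hx : (s • (1 : E →L[ℝ] E) + X) v = x := apply_inverse_apply (isUnit_shift hX hs) x
    have hc := shift_coercive h s v
    rw [hx, real_inner_comm] at hc
    have hm : 0 < min α 1 := lt_min hα one_pos
    have hle : min α 1 * (1 + s) ≤ s + α := by
      have := min_le_left α 1
      have := min_le_right α 1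
      nlinarith
    have hnn : 0 ≤ inner ℝ v x := le_trans (by positivity) hc
    rw [abs_of_nonneg hnn, mul_assoc, ← mul_inv, ← div_eq_mul_inv, le_div_iff₀ (by positivity)]
    have h3 : inner ℝ v x ≤ ‖v‖ * ‖x‖ := real_inner_le_norm _ _
    have h4 : (s + α) * ‖v‖ ≤ ‖x‖ := by
      rcases eq_or_ne v 0 with h5 | h5
      · simp [h5]
      · have : 0 < ‖v‖ := norm_pos_iff.2 h5
        nlinarith
    calc inner ℝ v x * (min α 1 * (1 + s)) ≤ (‖v‖ * ‖x‖) * (s + α) := by gcongr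
      _ = ((s + α) * ‖v‖) * ‖x‖ := by ring
      _ ≤ ‖x‖ * ‖x‖ := by gcongr
      _ = _ := by ring

theorem stieltjesForm_anti {τ : ℝ} (h0 : 0 < τ) (h1 : τ < 1) {X Y : E →L[ℝ] E}
    (hX : X ∈ strictlyPositive E) (hY : Y ∈ strictlyPositive E) (hXY : X ≤ Y) (x : E) :
    stieltjesForm τ Y x ≤ stieltjesForm τ X x := by
  refine setIntegral_mono_on (integrableOn_stieltjesForm h0 h1 hY x)
    (integrableOn_stieltjesForm h0 h1 hX x) measurableSet_Ioi fun s (hs : 0 < s) => ?_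
  refine mul_le_mul_of_nonneg_left ?_ (by positivity)
  refine inner_le_of_map_eq (isPositive_shift hX hs) ?_ (apply_inverse_apply (isUnit_shift hX hs) x)
    (apply_inverse_apply (isUnit_shift hY hs) x)
  rw [ContinuousLinearMap.le_def, add_sub_add_left_eq_sub]
  exact hXY

/-- Substitute `c s` for `s`. This homogeneity reduces the integral representation to operators of
norm one. -/
theorem stieltjesForm_smul (τ : ℝ) {X : E →L[ℝ] E} (hX : X ∈ strictlyPositive E) {c : ℝ}
    (hc : 0 < c) (x : E) : stieltjesForm τ (c • X) x = c ^ (-τ) * stieltjesForm τ X x := by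
  have h := integral_comp_mul_left_Ioi (fun s : ℝ => s ^ (-τ) * resolventForm (c • X) x s) 0 hc
  have h2 : ∫ s in Ioi (0 : ℝ), (c * s) ^ (-τ) * resolventForm (c • X) x (c * s) =
      ∫ s in Ioi (0 : ℝ), (c ^ (-τ) * c⁻¹) * (s ^ (-τ) * resolventForm X x s) := by
    refine setIntegral_congr_fun measurableSet_Ioi fun s (hs : 0 < s) => ?_
    have e : (c * s) • (1 : E →L[ℝ] E) + c • X = c • (s • (1 : E →L[ℝ] E) + X) := by
      rw [smul_add, smul_smul]
    simp only [resolventForm]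
    rw [e, inverse_smul hc.ne' (isUnit_shift hX hs), Real.mul_rpow hc.le hs.le,
      smul_apply, inner_smul_left, conj_trivial]
    ring
  rw [h2, integral_const_mul, mul_zero, smul_eq_mul] at h
  have hc' : c⁻¹ ≠ 0 := inv_ne_zero hc.ne'
  refine mul_left_cancel₀ hc' ?_
  rw [stieltjesForm, ← h, stieltjesForm]
  ring

/-- Neumann series for `s + 1 + W = (1 + s) (1 - T)` with `T = -W / (1 + s)`. -/
theorem hasSum_resolventForm {W : E →L[ℝ] E} (hW : ‖W‖ < 1) (x : E) {s : ℝ} (hs : 0 < s) :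
    HasSum (fun k : ℕ => ((1 + s) ^ (k + 1))⁻¹ * ((-1) ^ k * inner ℝ ((W ^ k) x) x))
      (resolventForm (1 + W) x s) := by
  have hs1 : 0 < 1 + s := by positivity
  set T : E →L[ℝ] E := (-(1 + s)⁻¹) • W with hT
  have hT1 : ‖T‖ < 1 := by
    rw [hT, norm_smul, norm_neg, Real.norm_of_nonneg (by positivity)]
    exact (mul_le_of_le_one_left (norm_nonneg _) (inv_le_one_of_one_le₀ (by linarith))).trans_lt hW
  have hsum : Summable fun k : ℕ => T ^ k :=
    (summable_geometric_of_lt_one (norm_nonneg T) hT1).of_norm_bounded (norm_pow_le_pow T)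
  have hmul1 : (∑' k : ℕ, T ^ k) * (1 - T) = 1 := geom_series_mul_neg T hT1
  have hmul2 : (1 - T) * (∑' k : ℕ, T ^ k) = 1 := mul_neg_geom_series T hT1
  have hinv : Ring.inverse (1 - T) = ∑' k : ℕ, T ^ k :=
    Ring.inverse_unit (⟨1 - T, ∑' k : ℕ, T ^ k, hmul2, hmul1⟩ : (E →L[ℝ] E)ˣ)
  have hu : IsUnit (1 - T) := ⟨⟨1 - T, ∑' k : ℕ, T ^ k, hmul2, hmul1⟩, rfl⟩
  have e : s • (1 : E →L[ℝ] E) + (1 + W) = (1 + s) • (1 - T) := by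
    rw [hT, neg_smul, sub_neg_eq_add, smul_add, smul_smul, mul_inv_cancel₀ hs1.ne', add_smul]
    simp
    abel
  rw [resolventForm, e, inverse_smul hs1.ne' hu, hinv, smul_apply,
    inner_smul_left, conj_trivial]
  have h := (((innerSL ℝ x).comp (ContinuousLinearMap.apply ℝ E x)).hasSum
    hsum.hasSum).mul_left (1 + s)⁻¹
  simp only [ContinuousLinearMap.comp_apply, ContinuousLinearMap.apply_apply,
    innerSL_apply_apply] at h
  rw [real_inner_comm]
  refine (congrArg (HasSum · _) (funext fun k => ?_)).mpr h
  rw [hT, smul_pow, smul_apply, inner_smul_right, neg_pow (1 + s)⁻¹, inv_pow,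
    real_inner_comm, pow_succ, mul_inv]
  ring

/-- Integrate the Neumann series term by term: the moments, proportional to `(-1)^k` times the
binomial coefficients, cancel the signs. Domination by `‖x‖² ‖W‖^k` times the zeroth moment
justifies the exchange. -/
theorem stieltjesForm_one_add {τ : ℝ} (h0 : 0 < τ) (h1 : τ < 1) {W : E →L[ℝ] E} (hW : ‖W‖ < 1)
    (x : E) :
    stieltjesForm τ (1 + W) x = stieltjesMoment τ 0 * inner ℝ (binomialSum (-τ) W x) x := by
  have hτ : |-τ| ≤ 1 := by rw [abs_neg, abs_of_pos h0]; exact h1.le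
  let F : ℕ → ℝ → ℝ := fun k s =>
    ((-1) ^ k * inner ℝ ((W ^ k) x) x) * (s ^ (-τ) * ((1 + s) ^ (k + 1))⁻¹)
  have hint : ∀ k, IntegrableOn (F k) (Ioi 0) := fun k =>
    (integrableOn_stieltjesMoment h0 h1 k).const_mul _
  have hsum : Summable fun k => ∫ s in Ioi (0 : ℝ), ‖F k s‖ := by
    refine ((summable_geometric_of_lt_one (norm_nonneg W) hW).mul_left
      (‖x‖ ^ 2 * stieltjesMoment τ 0)).of_nonneg_of_le
      (fun k => integral_nonneg fun s => norm_nonneg _) fun k => ?_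
    have e : ∫ s in Ioi (0 : ℝ), ‖F k s‖ = |inner ℝ ((W ^ k) x) x| * stieltjesMoment τ k := by
      rw [stieltjesMoment, ← integral_const_mul]
      refine setIntegral_congr_fun measurableSet_Ioi fun s (hs : 0 < s) => ?_
      have : 0 ≤ s ^ (-τ) * ((1 + s) ^ (k + 1))⁻¹ := by positivity
      simp only [F, norm_mul, norm_pow, norm_neg, norm_one, one_pow, one_mul, Real.norm_eq_abs]
      rw [← abs_mul, abs_of_nonneg this]
    have hx : |inner ℝ ((W ^ k) x) x| ≤ ‖x‖ ^ 2 * ‖W‖ ^ k := by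
      calc _ ≤ ‖(W ^ k) x‖ * ‖x‖ := abs_real_inner_le_norm _ _
        _ ≤ (‖W‖ ^ k * ‖x‖) * ‖x‖ := by
          gcongr
          exact (W ^ k).le_of_opNorm_le (norm_pow_le_pow W k) x
        _ = _ := by ring
    rw [e]
    calc _ ≤ (‖x‖ ^ 2 * ‖W‖ ^ k) * stieltjesMoment τ 0 :=
          mul_le_mul hx (stieltjesMoment_le h0 h1 k) (stieltjesMoment_nonneg τ k) (by positivity)
      _ = _ := by ring
  have h := hasSum_integral_of_summable_integral_norm hint hsum
  have e1 : ∫ s in Ioi (0 : ℝ), (∑' k, F k s) = stieltjesForm τ (1 + W) x := by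
    refine setIntegral_congr_fun measurableSet_Ioi fun s (hs : 0 < s) => ?_
    rw [← ((hasSum_resolventForm hW x hs).mul_left (s ^ (-τ))).tsum_eq]
    refine tsum_congr fun k => ?_
    simp only [F]
    ring
  rw [e1] at h
  refine h.unique ?_
  refine (congrArg (HasSum · _) (funext fun k => ?_)).mpr
    ((hasSum_inner_binomialSum hτ hW x x).mul_left (stieltjesMoment τ 0))
  rw [integral_const_mul]
  change _ * stieltjesMoment τ k = _
  rw [stieltjesMoment_eq h0 h1]
  have : ((-1 : ℝ) ^ k) * (-1) ^ k = 1 := by rw [← mul_pow]; simp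
  linear_combination (inner ℝ ((W ^ k) x) x * stieltjesMoment τ 0 * Ring.choose (-τ) k) * this

end

section

/-! ### Powers of strictly positive operators: the Löwner-Heinz inequality -/

variable {E : Type*} [NormedAddCommGroup E] [InnerProductSpace ℝ E]

theorem operatorRpow_eq (X : E →L[ℝ] E) (t : ℝ) :
    operatorRpow X t = ‖X‖ ^ t • binomialSum t (‖X‖⁻¹ • X - 1) := rfl

theorem isSymmetric_normalized_sub_one {X : E →L[ℝ] E} (hX : X.IsSymmetric) :
    (‖X‖⁻¹ • X - 1 : E →L[ℝ] E).IsSymmetric := fun x y => by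
  have := hX x y
  simp only [ContinuousLinearMap.coe_coe] at this
  simp [inner_sub_left, inner_sub_right, inner_smul_left, inner_smul_right, this]

theorem operatorRpow_zero (X : E →L[ℝ] E) : operatorRpow X 0 = 1 := by
  rw [operatorRpow_eq, binomialSum_zero, Real.rpow_zero, one_smul]

theorem operatorRpow_smul {X : E →L[ℝ] E} {c : ℝ} (hc : 0 < c) (t : ℝ) :
    operatorRpow (c • X) t = c ^ t • operatorRpow X t := by
  rw [operatorRpow_eq, operatorRpow_eq, norm_smul, Real.norm_of_nonneg hc.le, smul_smul,
    Real.mul_rpow hc.le (norm_nonneg _), smul_smul, mul_inv_rev, mul_assoc,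
    inv_mul_cancel₀ hc.ne', mul_one]

theorem operatorRpow_one [Nontrivial E] (t : ℝ) : operatorRpow (1 : E →L[ℝ] E) t = 1 := by
  rw [operatorRpow_eq, norm_one, inv_one, one_smul, sub_self, binomialSum_apply_zero,
    Real.one_rpow, one_smul]

theorem operatorRpow_smul_one [Nontrivial E] {c : ℝ} (hc : 0 < c) (t : ℝ) :
    operatorRpow (c • (1 : E →L[ℝ] E)) t = c ^ t • 1 := by
  rw [operatorRpow_smul hc, operatorRpow_one]

variable [CompleteSpace E]

section Nontrivial

variable [Nontrivial E]

theorem isSymmetric_operatorRpow {X : E →L[ℝ] E} (hX : X ∈ strictlyPositive E) {t : ℝ}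
    (ht : |t| ≤ 1) : (operatorRpow X t).IsSymmetric :=
  isSymmetric_smul (isSymmetric_binomialSum ht (norm_normalized_sub_one_lt hX)
    (isSymmetric_normalized_sub_one hX.1.isSymmetric)) _

theorem operatorRpow_mul_operatorRpow_neg {X : E →L[ℝ] E} (hX : X ∈ strictlyPositive E) {t : ℝ}
    (ht : |t| ≤ 1) : operatorRpow X t * operatorRpow X (-t) = 1 := by
  have hn := norm_pos_of_mem_strictlyPositive hX
  rw [operatorRpow_eq, operatorRpow_eq, smul_mul_smul_comm, ← Real.rpow_add hn, add_neg_cancel,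
    Real.rpow_zero, one_smul, binomialSum_mul_binomialSum_neg ht (norm_normalized_sub_one_lt hX)]

theorem stieltjesForm_eq {τ : ℝ} (h0 : 0 < τ) (h1 : τ < 1) {X : E →L[ℝ] E}
    (hX : X ∈ strictlyPositive E) (x : E) :
    stieltjesForm τ X x = stieltjesMoment τ 0 * inner ℝ (operatorRpow X (-τ) x) x := by
  have hn := norm_pos_of_mem_strictlyPositive hX
  have hX' := smul_mem_strictlyPositive (inv_pos.2 hn) hX
  have h := stieltjesForm_one_add h0 h1 (norm_normalized_sub_one_lt hX) x
  rw [add_sub_cancel] at h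
  have e : X = ‖X‖ • (‖X‖⁻¹ • X) := by rw [smul_smul, mul_inv_cancel₀ hn.ne', one_smul]
  conv_lhs => rw [e]
  rw [stieltjesForm_smul τ hX' hn, h, operatorRpow_eq, smul_apply,
    inner_smul_left, conj_trivial]
  ring

theorem operatorRpow_neg_anti {τ : ℝ} (h0 : 0 < τ) (h1 : τ < 1) {X Y : E →L[ℝ] E}
    (hX : X ∈ strictlyPositive E) (hY : Y ∈ strictlyPositive E) (hXY : X ≤ Y) :
    operatorRpow Y (-τ) ≤ operatorRpow X (-τ) := by
  have hτ : |-τ| ≤ 1 := by rw [abs_neg, abs_of_pos h0]; exact h1.le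
  rw [le_iff_forall_inner (isSymmetric_operatorRpow hY hτ) (isSymmetric_operatorRpow hX hτ)]
  intro x
  have h := stieltjesForm_anti h0 h1 hX hY hXY x
  rw [stieltjesForm_eq h0 h1 hX, stieltjesForm_eq h0 h1 hY] at h
  exact le_of_mul_le_mul_left h (stieltjesMoment_zero_pos h0 h1)

/-- Antitonicity applied to `X ≤ ‖X‖ • 1` gives the lower bound `‖X‖ ^ (-τ)`. -/
theorem operatorRpow_neg_mem {τ : ℝ} (h0 : 0 < τ) (h1 : τ < 1) {X : E →L[ℝ] E}
    (hX : X ∈ strictlyPositive E) : operatorRpow X (-τ) ∈ strictlyPositive E := by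
  have hτ : |-τ| ≤ 1 := by rw [abs_neg, abs_of_pos h0]; exact h1.le
  have hn := norm_pos_of_mem_strictlyPositive hX
  have h := operatorRpow_neg_anti h0 h1 hX (smul_one_mem_strictlyPositive hn)
    (le_norm_smul_one hX.1)
  rw [operatorRpow_smul_one hn] at h
  refine mem_strictlyPositive_of_inner (isSymmetric_operatorRpow hX hτ)
    (Real.rpow_pos_of_pos hn (-τ)) fun x => ?_
  simpa [inner_smul_left] using inner_le_of_le h x

/-- The **Löwner-Heinz inequality** for exponents in `(0, 1)`. -/
theorem operatorRpow_mono {τ : ℝ} (h0 : 0 < τ) (h1 : τ < 1) {X Y : E →L[ℝ] E}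
    (hX : X ∈ strictlyPositive E) (hY : Y ∈ strictlyPositive E) (hXY : X ≤ Y) :
    operatorRpow X τ ≤ operatorRpow Y τ := by
  have hτ : |τ| ≤ 1 := by rw [abs_of_pos h0]; exact h1.le
  have hinv : ∀ {Z : E →L[ℝ] E}, Z ∈ strictlyPositive E → ∀ x,
      operatorRpow Z (-τ) (operatorRpow Z τ x) = x := fun hZ x => by
    have := operatorRpow_mul_operatorRpow_neg hZ (t := -τ) (by rwa [abs_neg])
    rw [neg_neg] at this
    exact DFunLike.congr_fun this x
  rw [le_iff_forall_inner (isSymmetric_operatorRpow hX hτ) (isSymmetric_operatorRpow hY hτ)]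
  intro x
  -- `X^τ x` and `Y^τ x` are the preimages of `x` under `X^(-τ)` and `Y^(-τ)`, whose order is known.
  exact inner_le_of_map_eq (operatorRpow_neg_mem h0 h1 hY).1
    (operatorRpow_neg_anti h0 h1 hX hY hXY) (hinv hY x) (hinv hX x)

theorem operatorRpow_pos_mem {τ : ℝ} (h0 : 0 < τ) (h1 : τ < 1) {X : E →L[ℝ] E}
    (hX : X ∈ strictlyPositive E) : operatorRpow X τ ∈ strictlyPositive E := by
  have hτ : |τ| ≤ 1 := by rw [abs_of_pos h0]; exact h1.le
  obtain ⟨-, α, hα, hle⟩ := id hX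
  have h := operatorRpow_mono h0 h1 (smul_one_mem_strictlyPositive hα) hX hle
  rw [operatorRpow_smul_one hα] at h
  refine mem_strictlyPositive_of_inner (isSymmetric_operatorRpow hX hτ)
    (Real.rpow_pos_of_pos hα τ) fun x => ?_
  simpa [inner_smul_left] using inner_le_of_le h x

end Nontrivial

theorem mem_strictlyPositive_of_subsingleton [Subsingleton E] (A : E →L[ℝ] E) :
    A ∈ strictlyPositive E := by
  rw [Subsingleton.elim A ((1 : ℝ) • 1)]
  exact smul_one_mem_strictlyPositive one_pos

theorem operatorRpow_mem {t : ℝ} (ht : |t| < 1) {X : E →L[ℝ] E} (hX : X ∈ strictlyPositive E) :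
    operatorRpow X t ∈ strictlyPositive E := by
  rcases subsingleton_or_nontrivial E with hE | hE
  · exact mem_strictlyPositive_of_subsingleton _
  rw [abs_lt] at ht
  rcases lt_trichotomy t 0 with h | rfl | h
  · have := operatorRpow_neg_mem (τ := -t) (by linarith) (by linarith) hX
    rwa [neg_neg] at this
  · rw [operatorRpow_zero, ← one_smul ℝ (1 : E →L[ℝ] E)]
    exact smul_one_mem_strictlyPositive one_pos
  · exact operatorRpow_pos_mem h ht.2 hX

theorem operatorRpow_le_smul {t : ℝ} (ht : |t| < 1) {X Y : E →L[ℝ] E}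
    (hX : X ∈ strictlyPositive E) (hY : Y ∈ strictlyPositive E) {c : ℝ} (hc : 0 < c)
    (hXY : X ≤ c • Y) (hYX : Y ≤ c • X) :
    operatorRpow X t ≤ c ^ |t| • operatorRpow Y t := by
  rcases subsingleton_or_nontrivial E with hE | hE
  · exact (Subsingleton.elim _ _).le
  rw [abs_lt] at ht
  rcases lt_trichotomy t 0 with h | rfl | h
  · have := operatorRpow_neg_anti (τ := -t) (by linarith) (by linarith) hY
      (smul_mem_strictlyPositive hc hX) hYX
    rw [neg_neg, operatorRpow_smul hc] at this
    have h2 := smul_le_smul_of_le this (Real.rpow_nonneg hc.le (-t))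
    rwa [smul_smul, ← Real.rpow_add hc, neg_add_cancel, Real.rpow_zero, one_smul,
      ← abs_of_neg h] at h2
  · simp [operatorRpow_zero]
  · have := operatorRpow_mono h ht.2 hX (smul_mem_strictlyPositive hc hY) hXY
    rw [operatorRpow_smul hc] at this
    rwa [abs_of_pos h]

end

section

/-! ### The resolvent cocomposition of a positive operator -/

section

variable {E : Type*} [NormedAddCommGroup E] [InnerProductSpace ℝ E]

/-- Put `y = v + C M v`. Positivity of `C` gives `⟨M v, v⟩ ≤ ⟨M v, y⟩`, hence `‖M v‖ ≤ ‖M‖ ‖y‖`, and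
`v = y - C M v`. -/
theorem norm_le_mul_norm_one_add_mul {C M : E →L[ℝ] E} (hC : C.IsPositive) (hM : M.IsPositive)
    (v : E) : ‖v‖ ≤ (1 + ‖C‖ * ‖M‖) * ‖(1 + C * M : E →L[ℝ] E) v‖ := by
  have hy : (1 + C * M : E →L[ℝ] E) v = v + C (M v) := rfl
  rw [hy]
  set y := v + C (M v) with hyd
  have h1 : inner ℝ (M v) v ≤ ‖M v‖ * ‖y‖ := by
    refine le_trans ?_ (real_inner_le_norm (M v) y)
    rw [hyd, inner_add_right]
    have := hC.inner_nonneg_right (M v)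
    linarith
  have h2 := norm_map_sq_le hM (inner_map_self_le_norm M) v
  have h3 : ‖M v‖ ≤ ‖M‖ * ‖y‖ := by
    rcases eq_or_ne (M v) 0 with h | h
    · rw [h, norm_zero]; positivity
    · have hp : 0 < ‖M v‖ := norm_pos_iff.2 h
      have := mul_le_mul_of_nonneg_left h1 (norm_nonneg M)
      refine le_of_mul_le_mul_right ?_ hp
      nlinarith
  have h4 : v = y - C (M v) := by rw [hyd, add_sub_cancel_right]
  calc ‖v‖ = ‖y - C (M v)‖ := by rw [← h4]
    _ ≤ ‖y‖ + ‖C (M v)‖ := norm_sub_le _ _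
    _ ≤ ‖y‖ + ‖C‖ * (‖M‖ * ‖y‖) := by
      gcongr
      exact (C.le_opNorm _).trans (by gcongr)
    _ = _ := by ring

theorem isUnit_adjoint_mul_self [CompleteSpace E] {N : E →L[ℝ] E} {K : ℝ} (hK : 0 < K)
    (h : ∀ v, ‖v‖ ≤ K * ‖N v‖) : IsUnit (ContinuousLinearMap.adjoint N * N) := by
  refine isUnit_of_coercive (α := (K ^ 2)⁻¹) (by positivity) fun v => ?_
  have e : inner ℝ ((ContinuousLinearMap.adjoint N * N) v) v = ‖N v‖ ^ 2 := by
    rw [← real_inner_self_eq_norm_sq]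
    exact ContinuousLinearMap.adjoint_inner_left N v (N v)
  rw [e, inv_mul_le_iff₀ (by positivity), ← mul_pow]
  exact pow_le_pow_left₀ (norm_nonneg v) (h v) 2

/-- `N = 1 + C M` need not be self-adjoint, but `N` and `N* = 1 + M C` are both bounded below. So
`N* N` and `N N*` are coercive, and `N` has a left and a right inverse. -/
theorem isUnit_one_add_mul [CompleteSpace E] {C M : E →L[ℝ] E} (hC : C.IsPositive)
    (hM : M.IsPositive) : IsUnit (1 + C * M) := by
  have key : ∀ {C M : E →L[ℝ] E}, C.IsPositive → M.IsPositive →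
      IsUnit (ContinuousLinearMap.adjoint (1 + C * M) * (1 + C * M)) := fun {C M} hC hM =>
    isUnit_adjoint_mul_self (by positivity) (norm_le_mul_norm_one_add_mul hC hM)
  have hadj : ∀ {C M : E →L[ℝ] E}, C.IsPositive → M.IsPositive →
      ContinuousLinearMap.adjoint (1 + C * M) = 1 + M * C := fun {C M} hC hM => by
    rw [← ContinuousLinearMap.star_eq_adjoint, star_add, star_mul, star_one,
      hC.isSelfAdjoint.star_eq, hM.isSelfAdjoint.star_eq]
  have h1 := key hC hM
  have h2 := key hM hC
  rw [hadj hM hC] at h2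
  obtain ⟨a, ha⟩ := h1.exists_left_inv
  obtain ⟨b, hb⟩ := h2.exists_right_inv
  exact isUnit_iff_exists_and_exists.2 ⟨⟨(1 + M * C) * b, by rw [← mul_assoc, hb]⟩,
    ⟨a * ContinuousLinearMap.adjoint (1 + C * M), by rw [mul_assoc, ha]⟩⟩

end

variable {H G : Type*}
  [NormedAddCommGroup H] [InnerProductSpace ℝ H] [CompleteSpace H]
  [NormedAddCommGroup G] [InnerProductSpace ℝ G] [CompleteSpace G]

/-- The operator `Id - L ∘ L*`. -/
def defect (L : H →L[ℝ] G) : G →L[ℝ] G := 1 - L ∘L ContinuousLinearMap.adjoint L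

theorem defect_apply (L : H →L[ℝ] G) (u : G) :
    defect L u = u - L (ContinuousLinearMap.adjoint L u) := rfl

theorem isPositive_defect {L : H →L[ℝ] G} (hL : ‖L‖ ≤ 1) : (defect L).IsPositive := by
  refine (ContinuousLinearMap.isPositive_iff _).2 ⟨fun x y => ?_, fun x => ?_⟩
  · simp only [ContinuousLinearMap.coe_coe, defect_apply, inner_sub_left, inner_sub_right]
    rw [← ContinuousLinearMap.adjoint_inner_right L (ContinuousLinearMap.adjoint L x) y,
      ← ContinuousLinearMap.adjoint_inner_left L (ContinuousLinearMap.adjoint L y) x]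
  · rw [defect_apply, inner_sub_left, ← ContinuousLinearMap.adjoint_inner_right,
      real_inner_self_eq_norm_sq, real_inner_self_eq_norm_sq]
    have h : ‖ContinuousLinearMap.adjoint L x‖ ≤ 1 * ‖x‖ :=
      ContinuousLinearMap.le_of_opNorm_le _ (by rwa [LinearIsometryEquiv.norm_map]) x
    rw [one_mul] at h
    have := pow_le_pow_left₀ (norm_nonneg _) h 2
    linarith

/-- The solution operator `x ↦ u` of the equation `u = C (L x - γ (Id - L L*) u)`. -/
def cocompSolution (L : H →L[ℝ] G) (γ : ℝ) (C : G →L[ℝ] G) : H →L[ℝ] G :=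
  Ring.inverse (1 + C * (γ • defect L)) ∘L C ∘L L

/-- The resolvent cocomposition of the positive operator `C`, as a bounded operator. -/
def cocompOperator (L : H →L[ℝ] G) (γ : ℝ) (C : G →L[ℝ] G) : H →L[ℝ] H :=
  ContinuousLinearMap.adjoint L ∘L cocompSolution L γ C

theorem cocompSolution_unique {L : H →L[ℝ] G} (hL : ‖L‖ ≤ 1) {γ : ℝ} (hγ : 0 < γ)
    {C : G →L[ℝ] G} (hC : C.IsPositive) (x : H) (u : G) :
    u = C (L x - γ • defect L u) ↔ u = cocompSolution L γ C x := by
  have hu := isUnit_one_add_mul hC ((isPositive_defect hL).smul_of_nonneg hγ.le)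
  have e : (1 + C * (γ • defect L) : G →L[ℝ] G) u = u + C (γ • defect L u) := rfl
  have e2 : cocompSolution L γ C x = Ring.inverse (1 + C * (γ • defect L)) (C (L x)) := rfl
  rw [e2, map_sub, eq_sub_iff_add_eq, ← e]
  constructor
  · intro h
    rw [← h, inverse_apply_apply hu]
  · intro h
    rw [h, apply_inverse_apply hu]

/-- Unfolding gives `u = C (L (x + γ x') - γ u)`, with `x'` on both sides; substituting `x' = L* u`
turns the argument of `C` into `L x - γ (u - L L* u)`. -/
theorem mem_resolventCocomp_single {L : H →L[ℝ] G} {γ : ℝ} (C : G →L[ℝ] G) (x x' : H) :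
    x' ∈ resolventCocomp L γ (single C) x ↔
      ∃ u, u = C (L x - γ • defect L u) ∧ x' = ContinuousLinearMap.adjoint L u := by
  have hp : ∀ y u : G, u ∈ inverse (inverse (single C) + single fun y : G => (1 / γ)⁻¹ • y) y ↔
      u = C (y - γ • u) := fun y u => by
    simp only [inverse, single, Set.mem_ofPred_eq, Pi.add_apply, Set.add_singleton, Set.mem_image,
      Set.mem_singleton_iff, one_div, inv_inv]
    constructor
    · rintro ⟨p, hp, rfl⟩
      rwa [add_sub_cancel_right]
    · intro h
      exact ⟨_, h, sub_add_cancel _ _⟩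
  have h1 : x' ∈ resolventCocomp L γ (single C) x ↔
      x' ∈ {z | ∃ u, u = C (L (x + γ • x') - γ • u) ∧ z = ContinuousLinearMap.adjoint L u} := by
    simp only [resolventCocomp, resolventComp, parallelComp]
    rw [inverse, Set.mem_ofPred_eq, Pi.sub_apply]
    simp only [single, Set.sub_singleton, Set.mem_image, one_div, inv_inv]
    constructor
    · rintro ⟨p, ⟨u, ⟨y, rfl, hu⟩, hx'⟩, rfl⟩
      refine ⟨u, ?_, hx'⟩
      rw [sub_add_cancel]
      exact (hp _ _).1 (by simpa using hu)
    · rintro ⟨u, hu, hx'⟩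
      refine ⟨x + γ • x', ⟨u, ⟨_, rfl, ?_⟩, hx'⟩, add_sub_cancel_right _ _⟩
      have := (hp _ _).2 hu
      simpa using this
  rw [h1]
  refine exists_congr fun u => and_congr_left ?_
  rintro rfl
  rw [defect_apply, smul_sub, map_add, map_smul, add_sub_assoc, sub_sub_eq_add_sub, add_sub_assoc]

theorem resolventCocomp_single {L : H →L[ℝ] G} (hL : ‖L‖ ≤ 1) {γ : ℝ} (hγ : 0 < γ)
    {C : G →L[ℝ] G} (hC : C.IsPositive) :
    resolventCocomp L γ (single C) = single (cocompOperator L γ C) := by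
  funext x
  ext x'
  rw [mem_resolventCocomp_single]
  simp only [cocompSolution_unique hL hγ hC, exists_eq_left]
  rfl

theorem inner_cocompOperator (L : H →L[ℝ] G) (γ : ℝ) (C : G →L[ℝ] G) (x y : H) :
    inner ℝ (cocompOperator L γ C x) y = inner ℝ (cocompSolution L γ C x) (L y) :=
  ContinuousLinearMap.adjoint_inner_left L y _

/-! ### Variational form of the cocomposition -/

section

variable {L : H →L[ℝ] G} {γ : ℝ} {C : G →L[ℝ] G}

/-- Split `L y` as `(L y - γ M u) + γ M u`, with `u` the solution for `y`. The result is symmetric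
in `x` and `y` and visibly nonnegative on the diagonal. -/
theorem inner_cocompOperator_eq (hL : ‖L‖ ≤ 1) (hγ : 0 < γ) (hC : C.IsPositive) (x y : H) :
    inner ℝ (cocompOperator L γ C x) y =
      inner ℝ (C (L x - γ • defect L (cocompSolution L γ C x)))
        (L y - γ • defect L (cocompSolution L γ C y)) +
      γ * inner ℝ (defect L (cocompSolution L γ C y)) (cocompSolution L γ C x) := by
  rw [inner_cocompOperator, ← (cocompSolution_unique hL hγ hC x _).2 rfl, inner_sub_right,
    inner_smul_right, real_inner_comm (cocompSolution L γ C x)]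
  ring

theorem isPositive_cocompOperator (hL : ‖L‖ ≤ 1) (hγ : 0 < γ) (hC : C.IsPositive) :
    (cocompOperator L γ C).IsPositive := by
  have hM := isPositive_defect hL
  refine (ContinuousLinearMap.isPositive_iff _).2 ⟨fun x y => ?_, fun x => ?_⟩
  · simp only [ContinuousLinearMap.coe_coe]
    rw [real_inner_comm _ x, inner_cocompOperator_eq hL hγ hC x y,
      inner_cocompOperator_eq hL hγ hC y x, hC.inner_left_eq_inner_right, real_inner_comm,
      hM.inner_left_eq_inner_right, real_inner_comm (cocompSolution L γ C y)]
  · rw [inner_cocompOperator_eq hL hγ hC]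
    exact add_nonneg (hC.inner_nonneg_left _) (mul_nonneg hγ.le (hM.inner_nonneg_left _))

/-- The form of the resolvent cocomposition is an infimum of forms. -/
theorem inner_cocompOperator_le (hL : ‖L‖ ≤ 1) (hγ : 0 < γ) (hC : C.IsPositive) (x : H) (z : G) :
    inner ℝ (cocompOperator L γ C x) x ≤
      inner ℝ (C (L x - γ • defect L z)) (L x - γ • defect L z) + γ * inner ℝ (defect L z) z := by
  have hM := isPositive_defect hL
  have heq := inner_cocompOperator_eq hL hγ hC x x
  rw [heq]
  set u := cocompSolution L γ C x with hu
  have hCv : u = C (L x - γ • defect L u) := (cocompSolution_unique hL hγ hC x _).2 rfl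
  set v := L x - γ • defect L u with hv
  -- At `z = u + e` the terms linear in `e` cancel because `C v = u`. The excess is `γ² ⟨C M e, M e⟩
  -- + γ ⟨M e, e⟩ ≥ 0`.
  have hz : L x - γ • defect L z = v - γ • defect L (z - u) := by
    rw [hv, map_sub, smul_sub]
    abel
  set e := z - u with he
  have hze : z = u + e := by rw [he]; abel
  have h1 := hC.inner_nonneg_left (defect L e)
  have h2 := hM.inner_nonneg_left e
  have h3 : inner ℝ (C (defect L e)) v = inner ℝ (defect L e) u := by
    rw [hC.inner_left_eq_inner_right, ← hCv]
  have h4 : inner ℝ (defect L u) e = inner ℝ (defect L e) u := by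
    rw [hM.inner_left_eq_inner_right, real_inner_comm]
  rw [hz, hze]
  simp only [map_sub, map_add, map_smul, inner_sub_left, inner_sub_right, inner_add_left,
    inner_add_right, inner_smul_left, inner_smul_right, conj_trivial, ← hCv, h3, h4,
    real_inner_comm (defect L e) u]
  nlinarith [mul_nonneg (mul_nonneg hγ.le hγ.le) h1, mul_nonneg hγ.le h2]

/-- Test the infimum for `C` at the minimizer for `D`. The term in `M` does not scale with `C`; it
is absorbed because `c ≥ 1`. -/
theorem cocompOperator_le_smul (hL : ‖L‖ ≤ 1) (hγ : 0 < γ) (hC : C.IsPositive) {D : G →L[ℝ] G}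
    (hD : D.IsPositive) {c : ℝ} (hc : 1 ≤ c) (h : C ≤ c • D) :
    cocompOperator L γ C ≤ c • cocompOperator L γ D := by
  rw [le_iff_forall_inner (isPositive_cocompOperator hL hγ hC).isSymmetric
    (isSymmetric_smul (isPositive_cocompOperator hL hγ hD).isSymmetric c)]
  intro x
  have h1 := inner_cocompOperator_le hL hγ hC x (cocompSolution L γ D x)
  have h2 := inner_le_of_le h (L x - γ • defect L (cocompSolution L γ D x))
  have h3 := mul_nonneg hγ.le
    ((isPositive_defect hL).inner_nonneg_left (cocompSolution L γ D x))
  simp only [smul_apply, inner_smul_left, conj_trivial] at h2 ⊢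
  rw [inner_cocompOperator_eq hL hγ hD]
  nlinarith

/-- The resolvent cocomposition is strictly positive when the form of `C` is so on the range
of `L`. -/
theorem cocompOperator_mem (hL : ‖L‖ ≤ 1) (hγ : 0 < γ) (hC : C.IsPositive) {β : ℝ} (hβ : 0 < β)
    (h : ∀ x, β * ‖x‖ ^ 2 ≤ inner ℝ (C (L x)) (L x)) :
    cocompOperator L γ C ∈ strictlyPositive H := by
  have hM := isPositive_defect hL
  -- `K` bounds `‖1 + γ C M‖`, so `C L x = (1 + γ C M) u` gives `β ‖x‖ ≤ K ‖u‖`. Then `‖u‖² = ‖C v‖²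
  -- ≤ ‖C‖ ⟨C v, v⟩` is controlled by the form; `‖C‖ + 1` keeps the divisor nonzero.
  set K := 1 + ‖C‖ * (γ * ‖defect L‖) with hK
  have hKpos : 0 < K := by positivity
  have hb : 0 < ‖C‖ + 1 := by positivity
  refine mem_strictlyPositive_of_inner (isPositive_cocompOperator hL hγ hC).isSymmetric
    (α := (‖C‖ + 1)⁻¹ * (K⁻¹ * β) ^ 2) (by positivity) fun x => ?_
  set u := cocompSolution L γ C x with hu
  have hCv : u = C (L x - γ • defect L u) := (cocompSolution_unique hL hγ hC x _).2 rfl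
  have h1 : ‖C (L x)‖ ≤ K * ‖u‖ := by
    have e : C (L x) = u + C (γ • defect L u) := by
      rw [map_sub] at hCv
      nth_rewrite 1 [hCv]
      rw [sub_add_cancel]
    calc ‖C (L x)‖ = ‖u + C (γ • defect L u)‖ := by rw [e]
      _ ≤ ‖u‖ + ‖C‖ * ‖γ • defect L u‖ := (norm_add_le _ _).trans (by gcongr; exact C.le_opNorm _)
      _ ≤ ‖u‖ + ‖C‖ * (γ * (‖defect L‖ * ‖u‖)) := by
        rw [norm_smul, Real.norm_of_nonneg hγ.le]
        gcongr
        exact (defect L).le_opNorm u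
      _ = K * ‖u‖ := by rw [hK]; ring
  have h2 : β * ‖x‖ ≤ K * ‖u‖ := by
    rcases eq_or_ne x 0 with hx | hx
    · rw [hx, norm_zero, mul_zero]; positivity
    · have hxp : 0 < ‖x‖ := norm_pos_iff.2 hx
      have hLx : ‖L x‖ ≤ ‖x‖ := by simpa using L.le_of_opNorm_le hL x
      refine le_of_mul_le_mul_right ?_ hxp
      calc β * ‖x‖ * ‖x‖ = β * ‖x‖ ^ 2 := by ring
        _ ≤ ‖C (L x)‖ * ‖L x‖ := (h x).trans (real_inner_le_norm _ _)
        _ ≤ K * ‖u‖ * ‖x‖ := by gcongr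
  have h3 : K⁻¹ * β * ‖x‖ ≤ ‖u‖ := by rwa [mul_assoc, inv_mul_le_iff₀ hKpos]
  have h4 := norm_map_sq_le hC (inner_map_self_le_norm C) (L x - γ • defect L u)
  have h6 := hC.inner_nonneg_left (L x - γ • defect L u)
  have h5 : ‖u‖ ^ 2 ≤ (‖C‖ + 1) * inner ℝ (cocompOperator L γ C x) x := by
    rw [inner_cocompOperator_eq hL hγ hC, ← hu]
    rw [← hCv] at h4 h6 ⊢
    have h7 := mul_nonneg hb.le (mul_nonneg hγ.le (hM.inner_nonneg_left u))
    linarith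
  rw [mul_assoc, inv_mul_le_iff₀ hb, ← mul_pow]
  exact (pow_le_pow_left₀ (by positivity) h3 2).trans h5

theorem inner_cocompOperator_le_of_zero (hL : ‖L‖ ≤ 1) (hγ : 0 < γ) (hC : C.IsPositive) (x : H) :
    inner ℝ (cocompOperator L γ C x) x ≤ inner ℝ (C (L x)) (L x) := by
  simpa using inner_cocompOperator_le hL hγ hC x 0

end

/-! ### The resolvent cocomposition of `B* ∘ X ^ t ∘ B` -/

section

theorem inner_congrRpow (B X : G →L[ℝ] G) (t : ℝ) (x y : G) :
    inner ℝ (congrRpow B X t x) y = inner ℝ (operatorRpow X t (B x)) (B y) :=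
  ContinuousLinearMap.adjoint_inner_left B y (operatorRpow X t (B x))

variable {t : ℝ} {X Y : G →L[ℝ] G} (B : G →L[ℝ] G)

theorem isPositive_congrRpow (ht : |t| < 1) (hX : X ∈ strictlyPositive G) :
    (congrRpow B X t).IsPositive :=
  (operatorRpow_mem ht hX).1.adjoint_conj B

theorem congrRpow_le_smul (ht : |t| < 1) (hX : X ∈ strictlyPositive G)
    (hY : Y ∈ strictlyPositive G) {c : ℝ} (hc : 0 < c) (hXY : X ≤ c • Y) (hYX : Y ≤ c • X) :
    congrRpow B X t ≤ c ^ |t| • congrRpow B Y t := by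
  rw [le_iff_forall_inner (isPositive_congrRpow B ht hX).isSymmetric
    (isSymmetric_smul (isPositive_congrRpow B ht hY).isSymmetric _)]
  intro x
  have := inner_le_of_le (operatorRpow_le_smul ht hX hY hc hXY hYX) (B x)
  simpa [inner_smul_left, inner_congrRpow] using this

variable {L : H →L[ℝ] G} {γ : ℝ}

theorem cocompOperator_congrRpow_mem (hL : ‖L‖ ≤ 1) (hγ : 0 < γ) (ht : |t| < 1)
    (hX : X ∈ strictlyPositive G) (hBL : IsBoundedBelow (B ∘L L)) :
    cocompOperator L γ (congrRpow B X t) ∈ strictlyPositive H := by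
  obtain ⟨α, hα, h⟩ := hBL
  obtain ⟨-, β, hβ, h'⟩ := mem_strictlyPositive_iff.1 (operatorRpow_mem ht hX)
  refine cocompOperator_mem hL hγ (isPositive_congrRpow B ht hX) (β := β * α ^ 2) (by positivity)
    fun x => ?_
  rw [inner_congrRpow]
  refine le_trans ?_ (h' _)
  rw [mul_assoc, ← mul_pow]
  gcongr
  exact h x

theorem isBoundedBelow_of_cocompOperator_mem (hL : ‖L‖ ≤ 1) (hγ : 0 < γ) (ht : |t| < 1)
    (hX : X ∈ strictlyPositive G)
    (h : cocompOperator L γ (congrRpow B X t) ∈ strictlyPositive H) :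
    IsBoundedBelow (B ∘L L) := by
  obtain ⟨-, α, hα, h⟩ := mem_strictlyPositive_iff.1 h
  set K := ‖operatorRpow X t‖ + 1 with hK
  have hKpos : 0 < K := by positivity
  refine ⟨Real.sqrt (K⁻¹ * α), by positivity, fun x => ?_⟩
  refine le_of_sq_le_sq ?_ (norm_nonneg _)
  rw [mul_pow, Real.sq_sqrt (by positivity), mul_assoc, inv_mul_le_iff₀ hKpos]
  refine (h x).trans ((inner_cocompOperator_le_of_zero hL hγ (isPositive_congrRpow B ht hX)
    x).trans ?_)
  rw [inner_congrRpow]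
  refine (inner_map_self_le_norm _ _).trans ?_
  change _ ≤ K * ‖B (L x)‖ ^ 2
  gcongr
  rw [hK]
  linarith

theorem cocompOperator_congrRpow_le_smul (hL : ‖L‖ ≤ 1) (hγ : 0 < γ) (ht : |t| < 1)
    (hX : X ∈ strictlyPositive G) (hY : Y ∈ strictlyPositive G) {c : ℝ} (hc : 1 ≤ c)
    (hXY : X ≤ c • Y) (hYX : Y ≤ c • X) :
    cocompOperator L γ (congrRpow B X t) ≤ c ^ |t| • cocompOperator L γ (congrRpow B Y t) :=
  cocompOperator_le_smul hL hγ (isPositive_congrRpow B ht hX) (isPositive_congrRpow B ht hY)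
    (Real.one_le_rpow hc (abs_nonneg t))
    (congrRpow_le_smul B ht hX hY (by linarith) hXY hYX)

end

end

section

/-! ### The Thompson metric -/

section Thompson

variable {E : Type*} [NormedAddCommGroup E] [InnerProductSpace ℝ E]

theorem single_injective_continuousLinearMap {A B : E →L[ℝ] E}
    (h : single (A : E → E) = single (B : E → E)) : A = B := by
  ext x
  exact Set.singleton_injective (congrFun h x)

theorem thompsonGauge_nonneg (A B : E →L[ℝ] E) : 0 ≤ thompsonGauge A B :=
  Real.sInf_nonneg fun _ hl => hl.1.le

theorem thompsonGauge_le {A B : E →L[ℝ] E} {l : ℝ} (hl : 0 < l) (h : A ≤ l • B) :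
    thompsonGauge A B ≤ l :=
  csInf_le ⟨0, fun _ hl => hl.1.le⟩ ⟨hl, h⟩

theorem thompsonGauge_le_zero_of_subsingleton [Subsingleton E] (A B : E →L[ℝ] E) :
    thompsonGauge A B ≤ 0 :=
  le_of_forall_pos_le_add fun ε hε => by
    rw [zero_add]
    exact thompsonGauge_le hε (Subsingleton.elim _ _).le

theorem thompsonDist_comm (A B : E →L[ℝ] E) : thompsonDist A B = thompsonDist B A := by
  rw [thompsonDist, thompsonDist, max_comm]

theorem le_exp_add_smul {A B C : E →L[ℝ] E} {r s : ℝ} (h1 : A ≤ Real.exp r • B)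
    (h2 : B ≤ Real.exp s • C) : A ≤ Real.exp (r + s) • C := by
  refine h1.trans ((smul_le_smul_of_le h2 (Real.exp_pos r).le).trans ?_)
  rw [smul_smul, Real.exp_add]

/-- With `c = (e^r - 1) b`, the hypotheses give `-c ≤ A - B ≤ c`; shifting by `c` yields a positive
operator of norm at most `2 c`. -/
theorem norm_sub_le_of_exp {A B : E →L[ℝ] E} (hA : A.IsPositive) (hB : B.IsPositive) {r b : ℝ}
    (hr : 0 ≤ r) (hb : 0 ≤ b) (hAB : ∀ x, inner ℝ (A x) x ≤ Real.exp r * inner ℝ (B x) x)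
    (hBA : ∀ x, inner ℝ (B x) x ≤ Real.exp r * inner ℝ (A x) x)
    (hAb : ∀ x, inner ℝ (A x) x ≤ b * ‖x‖ ^ 2) (hBb : ∀ x, inner ℝ (B x) x ≤ b * ‖x‖ ^ 2) :
    ‖A - B‖ ≤ 3 * ((Real.exp r - 1) * b) := by
  have he : 0 ≤ Real.exp r - 1 := sub_nonneg.2 (Real.one_le_exp hr)
  set c := (Real.exp r - 1) * b with hc
  have hc0 : 0 ≤ c := mul_nonneg he hb
  have hform : ∀ x, inner ℝ ((A - B + c • (1 : E →L[ℝ] E)) x) x =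
      inner ℝ (A x) x - inner ℝ (B x) x + c * ‖x‖ ^ 2 := fun x => by
    simp [inner_add_left, inner_sub_left, inner_smul_left]
  have hsymm : (A - B + c • (1 : E →L[ℝ] E)).IsSymmetric := fun x y => by
    simp [inner_add_left, inner_sub_left, inner_smul_left, inner_add_right, inner_sub_right,
      inner_smul_right, hA.inner_left_eq_inner_right, hB.inner_left_eq_inner_right]
  have hpos : (A - B + c • (1 : E →L[ℝ] E)).IsPositive := by
    refine (ContinuousLinearMap.isPositive_iff _).2 ⟨hsymm, fun x => ?_⟩
    rw [hform]
    have h1 := hBA x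
    have h2 := mul_le_mul_of_nonneg_left (hAb x) he
    rw [← mul_assoc, ← hc] at h2
    linarith
  have h1 : ‖A - B + c • (1 : E →L[ℝ] E)‖ ≤ 2 * c := by
    refine norm_le_of_forall_inner_le hpos (by positivity) fun x => ?_
    rw [hform]
    have h1 := hAB x
    have h2 := mul_le_mul_of_nonneg_left (hBb x) he
    rw [← mul_assoc, ← hc] at h2
    linarith
  have h2 : ‖c • (1 : E →L[ℝ] E)‖ ≤ c := by
    rw [norm_smul, Real.norm_of_nonneg hc0]
    exact mul_le_of_le_one_right hc0 ContinuousLinearMap.norm_id_le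
  calc ‖A - B‖ = ‖(A - B + c • (1 : E →L[ℝ] E)) - c • (1 : E →L[ℝ] E)‖ := by
        rw [add_sub_cancel_right]
    _ ≤ 2 * c + c := (norm_sub_le _ _).trans (add_le_add h1 h2)
    _ = 3 * c := by ring

variable [CompleteSpace E]

theorem exists_le_smul {A B : E →L[ℝ] E} (hA : A ∈ strictlyPositive E)
    (hB : B ∈ strictlyPositive E) : ∃ l : ℝ, 0 < l ∧ A ≤ l • B := by
  obtain ⟨-, β, hβ, h⟩ := hB
  refine ⟨(‖A‖ + 1) * β⁻¹, by positivity, ?_⟩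
  have h1 := smul_le_smul_of_le h (c := (‖A‖ + 1) * β⁻¹) (by positivity)
  rw [smul_smul, mul_assoc, inv_mul_cancel₀ hβ.ne', mul_one] at h1
  refine ((le_norm_smul_one hA.1).trans ?_).trans h1
  exact smul_le_smul_of_coeff_le ContinuousLinearMap.isPositive_one (by linarith)

/-- The infimum is attained: for each `x` the admissible scalars satisfy a closed inequality. -/
theorem le_thompsonGauge_smul {A B : E →L[ℝ] E} (hA : A ∈ strictlyPositive E)
    (hB : B ∈ strictlyPositive E) : A ≤ thompsonGauge A B • B := by
  rw [le_iff_forall_inner hA.1.isSymmetric (isSymmetric_smul hB.1.isSymmetric _)]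
  intro x
  obtain ⟨l, hl⟩ := exists_le_smul hA hB
  have key : ∀ l : ℝ, A ≤ l • B → inner ℝ (A x) x ≤ l * inner ℝ (B x) x := fun l h => by
    simpa [inner_smul_left] using inner_le_of_le h x
  rw [smul_apply, inner_smul_left, conj_trivial]
  rcases (hB.1.inner_nonneg_left x).eq_or_lt with h0 | h0
  · have := key l hl.2
    rw [← h0, mul_zero] at this ⊢
    exact this
  · rw [← div_le_iff₀ h0]
    exact le_csInf ⟨l, hl⟩ fun m hm => (div_le_iff₀ h0).2 (key m hm.2)

theorem thompsonDist_nonneg {A B : E →L[ℝ] E} (hA : A ∈ strictlyPositive E)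
    (hB : B ∈ strictlyPositive E) : 0 ≤ thompsonDist A B := by
  -- On the zero space both gauges are `0`, and `Real.log 0 = 0` gives the conventional distance.
  rcases subsingleton_or_nontrivial E with hE | hE
  · have h1 : thompsonGauge A B = 0 :=
      le_antisymm (thompsonGauge_le_zero_of_subsingleton A B) (thompsonGauge_nonneg A B)
    have h2 : thompsonGauge B A = 0 :=
      le_antisymm (thompsonGauge_le_zero_of_subsingleton B A) (thompsonGauge_nonneg B A)
    simp [thompsonDist, h1, h2]
  · refine Real.log_nonneg ?_
    by_contra! hlt
    rw [max_lt_iff] at hlt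
    obtain ⟨-, α, hα, h⟩ := mem_strictlyPositive_iff.1 hA
    obtain ⟨x, hx⟩ := exists_ne (0 : E)
    have hpos : 0 < inner ℝ (A x) x := lt_of_lt_of_le (by positivity) (h x)
    have hB0 := hB.1.inner_nonneg_left x
    have h1 := inner_le_of_le (le_thompsonGauge_smul hA hB) x
    have h2 := inner_le_of_le (le_thompsonGauge_smul hB hA) x
    simp only [smul_apply, inner_smul_left, conj_trivial] at h1 h2
    nlinarith

theorem thompsonDist_le_iff {A B : E →L[ℝ] E} (hA : A ∈ strictlyPositive E)
    (hB : B ∈ strictlyPositive E) {r : ℝ} (hr : 0 ≤ r) :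
    thompsonDist A B ≤ r ↔ A ≤ Real.exp r • B ∧ B ≤ Real.exp r • A := by
  have hexp := Real.exp_pos r
  have h0 : 0 ≤ max (thompsonGauge A B) (thompsonGauge B A) :=
    le_max_of_le_left (thompsonGauge_nonneg A B)
  have hiff : thompsonDist A B ≤ r ↔
      max (thompsonGauge A B) (thompsonGauge B A) ≤ Real.exp r := by
    rw [thompsonDist]
    rcases h0.eq_or_lt with h | h
    · rw [← h, Real.log_zero]
      exact iff_of_true hr hexp.le
    · exact Real.log_le_iff_le_exp h
  rw [hiff, max_le_iff]
  refine and_congr ⟨fun h => ?_, thompsonGauge_le hexp⟩ ⟨fun h => ?_, thompsonGauge_le hexp⟩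
  · exact (le_thompsonGauge_smul hA hB).trans (smul_le_smul_of_coeff_le hB.1 h)
  · exact (le_thompsonGauge_smul hB hA).trans (smul_le_smul_of_coeff_le hA.1 h)

theorem le_exp_thompsonDist_smul {A B : E →L[ℝ] E} (hA : A ∈ strictlyPositive E)
    (hB : B ∈ strictlyPositive E) : A ≤ Real.exp (thompsonDist A B) • B :=
  ((thompsonDist_le_iff hA hB (thompsonDist_nonneg hA hB)).1 le_rfl).1

theorem thompsonDist_triangle {A B C : E →L[ℝ] E} (hA : A ∈ strictlyPositive E)
    (hB : B ∈ strictlyPositive E) (hC : C ∈ strictlyPositive E) :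
    thompsonDist A C ≤ thompsonDist A B + thompsonDist B C := by
  refine (thompsonDist_le_iff hA hC
    (add_nonneg (thompsonDist_nonneg hA hB) (thompsonDist_nonneg hB hC))).2
    ⟨le_exp_add_smul (le_exp_thompsonDist_smul hA hB) (le_exp_thompsonDist_smul hB hC), ?_⟩
  rw [add_comm, thompsonDist_comm A B, thompsonDist_comm B C]
  exact le_exp_add_smul (le_exp_thompsonDist_smul hC hB) (le_exp_thompsonDist_smul hB hA)

variable (E) in
/-- The strictly positive operators, as a metric space for the Thompson metric. -/
def ThompsonSpace : Type _ := ↥(strictlyPositive E)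

instance : MetricSpace (ThompsonSpace E) where
  dist A B := thompsonDist A.1 B.1
  dist_self A := le_antisymm
    ((thompsonDist_le_iff A.2 A.2 le_rfl).2 (by simp)) (thompsonDist_nonneg A.2 A.2)
  dist_comm A B := thompsonDist_comm A.1 B.1
  dist_triangle A B C := thompsonDist_triangle A.2 B.2 C.2
  eq_of_dist_eq_zero {A B} h := by
    have := (thompsonDist_le_iff A.2 B.2 le_rfl).1 h.le
    rw [Real.exp_zero, one_smul, one_smul] at this
    exact Subtype.ext (le_antisymm this.1 this.2)

theorem ThompsonSpace.inner_le (A B : ThompsonSpace E) {r : ℝ} (hr : dist A B ≤ r) (x : E) :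
    inner ℝ (A.1 x) x ≤ Real.exp r * inner ℝ (B.1 x) x := by
  have h := ((thompsonDist_le_iff A.2 B.2 (dist_nonneg.trans hr)).1 hr).1
  simpa [inner_smul_left] using inner_le_of_le h x

instance : Nonempty (ThompsonSpace E) :=
  ⟨⟨(1 : ℝ) • 1, smul_one_mem_strictlyPositive one_pos⟩⟩

/-- A Thompson-Cauchy sequence is bounded in the Loewner order, hence norm-Cauchy. The bound `u 0 ≤
e^R u n` keeps the norm limit strictly positive, and the estimates between `u n` and `u m` survive
the limit in `m`. -/
instance : CompleteSpace (ThompsonSpace E) := by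
  refine Metric.complete_of_cauchySeq_tendsto fun u hu => ?_
  obtain ⟨R, hR, hbd⟩ := cauchySeq_bdd hu
  set b := Real.exp R * ‖(u 0).1‖ with hb
  have hb0 : 0 ≤ b := by positivity
  have hub : ∀ n x, inner ℝ ((u n).1 x) x ≤ b * ‖x‖ ^ 2 := fun n x => by
    refine ((u n).inner_le (u 0) (hbd n 0).le x).trans ?_
    rw [hb, mul_assoc]
    gcongr
    exact inner_map_self_le_norm _ _
  have hcauchy : CauchySeq fun n => (u n).1 := by
    refine Metric.cauchySeq_iff'.2 fun ε hε => ?_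
    -- The radius `log (1 + δ)` makes `e^r - 1 = δ`, so the norm bound is `3 b δ < ε`, also when `b
    -- = 0`.
    have hδ : 0 < ε / (3 * b + 1) := by positivity
    have hr : 0 < Real.log (1 + ε / (3 * b + 1)) := Real.log_pos (by linarith)
    obtain ⟨N, hN⟩ := Metric.cauchySeq_iff'.1 hu _ hr
    refine ⟨N, fun n hn => ?_⟩
    have hd := (hN n hn).le
    have h := norm_sub_le_of_exp (u n).2.1 (u N).2.1 hr.le hb0 ((u n).inner_le (u N) hd)
      ((u N).inner_le (u n) (by rwa [dist_comm])) (hub n) (hub N)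
    rw [Real.exp_log (by linarith), add_sub_cancel_left] at h
    rw [dist_eq_norm]
    refine h.trans_lt ?_
    rw [div_mul_eq_mul_div, ← mul_div_assoc, div_lt_iff₀ (by positivity)]
    nlinarith
  obtain ⟨A, hA⟩ := cauchySeq_tendsto_of_complete hcauchy
  have hform : ∀ x y, Filter.Tendsto (fun n => inner ℝ ((u n).1 x) y) Filter.atTop
      (𝓝 (inner ℝ (A x) y)) := fun x y =>
    (((ContinuousLinearMap.apply ℝ E x).continuous.tendsto A).comp hA).inner tendsto_const_nhds
  have hsymm : A.IsSymmetric := fun x y => by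
    refine tendsto_nhds_unique (hform x y) ?_
    simp only [ContinuousLinearMap.coe_coe]
    rw [real_inner_comm]
    refine (hform y x).congr fun n => ?_
    rw [(u n).2.1.inner_left_eq_inner_right, real_inner_comm]
  obtain ⟨-, α, hα, hα0⟩ := mem_strictlyPositive_iff.1 (u 0).2
  have hAmem : A ∈ strictlyPositive E := by
    refine mem_strictlyPositive_of_inner hsymm (α := (Real.exp R)⁻¹ * α) (by positivity)
      fun x => ge_of_tendsto' (hform x x) fun n => ?_
    rw [mul_assoc, inv_mul_le_iff₀ (Real.exp_pos R)]
    exact (hα0 x).trans ((u 0).inner_le (u n) (hbd 0 n).le x)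
  refine ⟨⟨A, hAmem⟩, Metric.tendsto_atTop.2 fun ε hε => ?_⟩
  obtain ⟨N, hN⟩ := Metric.cauchySeq_iff.1 hu (ε / 2) (half_pos hε)
  refine ⟨N, fun n hn => lt_of_le_of_lt ?_ (half_lt_self hε)⟩
  have hev : ∀ᶠ m in Filter.atTop, N ≤ m := Filter.eventually_ge_atTop N
  refine (thompsonDist_le_iff (u n).2 hAmem (half_pos hε).le).2 ⟨?_, ?_⟩
  · rw [le_iff_forall_inner (u n).2.1.isSymmetric (isSymmetric_smul hsymm _)]
    intro x
    rw [smul_apply, inner_smul_left, conj_trivial]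
    refine ge_of_tendsto ((hform x x).const_mul _) (hev.mono fun m hm => ?_)
    exact (u n).inner_le (u m) (hN n hn m hm).le x
  · rw [le_iff_forall_inner hsymm (isSymmetric_smul (u n).2.1.isSymmetric _)]
    intro x
    rw [smul_apply, inner_smul_left, conj_trivial]
    refine le_of_tendsto (hform x x) (hev.mono fun m hm => ?_)
    exact (u m).inner_le (u n) (hN m hm n hn).le x

end Thompson

variable {H G : Type*}
  [NormedAddCommGroup H] [InnerProductSpace ℝ H] [CompleteSpace H]
  [NormedAddCommGroup G] [InnerProductSpace ℝ G] [CompleteSpace G]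

/-- Take `c = exp (thompsonDist X Y) ≥ 1`, so that `c ^ |t|` is the exponential of the claimed
bound. -/
theorem thompsonDist_cocompOperator_le (B : G →L[ℝ] G) {L : H →L[ℝ] G} (hL : ‖L‖ ≤ 1) {γ : ℝ}
    (hγ : 0 < γ) {t : ℝ} (ht : |t| < 1) {X Y : G →L[ℝ] G} (hX : X ∈ strictlyPositive G)
    (hY : Y ∈ strictlyPositive G) (hBL : IsBoundedBelow (B ∘L L)) :
    thompsonDist (cocompOperator L γ (congrRpow B X t)) (cocompOperator L γ (congrRpow B Y t)) ≤
      |t| * thompsonDist X Y := by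
  have h0 := thompsonDist_nonneg hX hY
  have h1 := Real.one_le_exp h0
  have hXY := le_exp_thompsonDist_smul hX hY
  have hYX := le_exp_thompsonDist_smul hY hX
  rw [thompsonDist_comm Y X] at hYX
  rw [thompsonDist_le_iff (cocompOperator_congrRpow_mem B hL hγ ht hX hBL)
    (cocompOperator_congrRpow_mem B hL hγ ht hY hBL) (mul_nonneg (abs_nonneg t) h0),
    mul_comm, Real.exp_mul]
  exact ⟨cocompOperator_congrRpow_le_smul B hL hγ ht hX hY h1 hXY hYX,
    cocompOperator_congrRpow_le_smul B hL hγ ht hY hX h1 hYX hXY⟩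

theorem existsUnique_eq_cocompOperator (B : G →L[ℝ] G) {L : G →L[ℝ] G} (hL : ‖L‖ ≤ 1) {γ : ℝ}
    (hγ : 0 < γ) {t : ℝ} (ht : |t| < 1) (hBL : IsBoundedBelow (B ∘L L)) :
    ∃! X : ThompsonSpace G, X.1 = cocompOperator L γ (congrRpow B X.1 t) := by
  let f : ThompsonSpace G → ThompsonSpace G := fun X =>
    ⟨cocompOperator L γ (congrRpow B X.1 t), cocompOperator_congrRpow_mem B hL hγ ht X.2 hBL⟩
  have hf : ContractingWith ⟨|t|, abs_nonneg t⟩ f :=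
    ⟨by exact_mod_cast ht, LipschitzWith.of_dist_le_mul fun X Y =>
      thompsonDist_cocompOperator_le B hL hγ ht X.2 Y.2 hBL⟩
  refine ⟨hf.fixedPoint f, ?_, fun Y hY => ?_⟩
  · exact (congrArg Subtype.val hf.fixedPoint_isFixedPt).symm
  · exact hf.fixedPoint_unique (x := Y) (Subtype.ext hY.symm)

end

end ResolventComposition

end

/-! ### Proof of (i) and (ii) -/

open ResolventComposition

theorem proposition5p5 {H G : Type*}
    [NormedAddCommGroup H] [InnerProductSpace ℝ H] [CompleteSpace H]
    [NormedAddCommGroup G] [InnerProductSpace ℝ G] [CompleteSpace G]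
    (B : G →L[ℝ] G)
    (hB : ∃ Bn : ℕ → G →L[ℝ] G,
      (∀ n, IsUnit (Bn n)) ∧ Filter.Tendsto Bn Filter.atTop (𝓝 B))
    (γ : ℝ) (hγ : 0 < γ) (t : ℝ) (ht : t ∈ Set.Ioo (-1 : ℝ) 1) :
    -- the map `φ` and part (i)
    (∀ L : H →L[ℝ] G, ResolventComposition.IsBoundedBelow L → ‖L‖ ≤ 1 →
      ((∃ φ : ResolventComposition.strictlyPositive G → ResolventComposition.strictlyPositive H,
          ∀ X, ResolventComposition.resolventCocomp L γ
              (ResolventComposition.single (ResolventComposition.congrRpow B X.1 t)) =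
            ResolventComposition.single (φ X).1) ↔
        ResolventComposition.IsBoundedBelow (B ∘L L)) ∧
      ∀ φ : ResolventComposition.strictlyPositive G → ResolventComposition.strictlyPositive H,
        (∀ X, ResolventComposition.resolventCocomp L γ
            (ResolventComposition.single (ResolventComposition.congrRpow B X.1 t)) =
          ResolventComposition.single (φ X).1) →
        ∀ X Y, ResolventComposition.thompsonDist (φ X).1 (φ Y).1 ≤
          |t| * ResolventComposition.thompsonDist X.1 Y.1) ∧
    -- part (ii), where the two spaces coincide
    (∀ L : G →L[ℝ] G, ResolventComposition.IsBoundedBelow L → ‖L‖ ≤ 1 →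
      ResolventComposition.IsBoundedBelow (B ∘L L) →
      ∃! X : ResolventComposition.strictlyPositive G,
        ResolventComposition.single X.1 = ResolventComposition.resolventCocomp L γ
          (ResolventComposition.single (ResolventComposition.congrRpow B X.1 t))) := by
  have ht' : |t| < 1 := abs_lt.2 ht
  refine ⟨fun L _ hL => ?_, fun L _ hL hBL => ?_⟩
  · have hco : ∀ X : strictlyPositive G, resolventCocomp L γ (single (congrRpow B X.1 t)) =
        single (cocompOperator L γ (congrRpow B X.1 t)) := fun X =>
      resolventCocomp_single hL hγ (isPositive_congrRpow B ht' X.2)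
    have hiff : (∃ φ : strictlyPositive G → strictlyPositive H, ∀ X,
        resolventCocomp L γ (single (congrRpow B X.1 t)) = single (φ X).1) ↔
        IsBoundedBelow (B ∘L L) := by
      refine ⟨fun ⟨φ, hφ⟩ => ?_, fun hBL => ?_⟩
      -- Strict positivity of the single value at `X = Id` already forces `B L` to be bounded below.
      · have hI : (1 : ℝ) • (1 : G →L[ℝ] G) ∈ strictlyPositive G :=
          smul_one_mem_strictlyPositive one_pos
        have h := single_injective_continuousLinearMap ((hco ⟨_, hI⟩).symm.trans (hφ ⟨_, hI⟩))
        refine isBoundedBelow_of_cocompOperator_mem B hL hγ ht' hI ?_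
        rw [h]
        exact (φ ⟨_, hI⟩).2
      · exact ⟨fun X => ⟨_, cocompOperator_congrRpow_mem B hL hγ ht' X.2 hBL⟩, hco⟩
    refine ⟨hiff, fun φ hφ X Y => ?_⟩
    rw [← single_injective_continuousLinearMap ((hco X).symm.trans (hφ X)),
      ← single_injective_continuousLinearMap ((hco Y).symm.trans (hφ Y))]
    exact thompsonDist_cocompOperator_le B hL hγ ht' X.2 Y.2 (hiff.1 ⟨φ, hφ⟩)
  · have hco : ∀ X : strictlyPositive G, resolventCocomp L γ (single (congrRpow B X.1 t)) =
        single (cocompOperator L γ (congrRpow B X.1 t)) := fun X =>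
      resolventCocomp_single hL hγ (isPositive_congrRpow B ht' X.2)
    obtain ⟨X, hX, huniq⟩ := existsUnique_eq_cocompOperator B hL hγ ht' hBL
    refine ⟨X, ?_, fun Y hY => huniq Y ?_⟩
    · exact (congrArg (fun A : G →L[ℝ] G => single (A : G → G)) hX).trans (hco X).symm
    · exact single_injective_continuousLinearMap (hY.trans (hco Y))
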